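/- Let $\overline{\mathbb Q}\subset\mathbb C$ be the field of algebraic numbers. A power series $\sum_{n\ge 0}\frac{a_n}{n!}z^n$ with $a_n\in\overline{\mathbb Q}$ is an $E$-function if it satisfies a non-zero linear differential equation over $\overline{\mathbb Q}(z)$, the numbers $|\sigma(a_n)|$ ($\sigma\in\mathrm{Gal}(\overline{\mathbb Q}/\mathbb Q)$) are bounded by $C^{n+1}$ for some constant $C>0$, and the least common denominator of $a_0,\dots,a_n$ grows at most exponentially in $n$. In that case $\sum_{n\ge 0} a_nx^n$ is called a $G$-function and $\sum_{n\ge0} n!\,a_nz^n$ an arithmetic Gevrey series of order $1$. Let $\mathfrak f(z)=\sum_{n\ge0} n!\,a_nz^n$ be an arithmetic Gevrey series of order $1$. A real number $\theta$ is not an anti-Stokes direction of $\mathfrak f$ if $\mathfrak f(1/z)$ is $1$-summable in the direction $\theta$, that is, if $\sum a_nx^n$ extends to a holomorphic function $B$ on the union of a disc centred at $0$ and an open sector around the ray $\arg x=-\theta$, with $B(x)=O(e^{K|x|})$ on the sector for every $K>0$. The $1$-sum in the direction $\theta$ is then given, for $\mathrm{Re}(ze^{-i\theta})>0$, by $\mathfrak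 f_\theta(1/z)=z\int_0^{\infty e^{-i\theta}}B(x)e^{-xz}\,dx$. A mixed function is a formal series $\Psi(z)=\sum_{n\in\mathbb Z}a_nz^n$ such that $F(z)=\sum_{n\ge0}a_nz^n$ is an $E$-function and $\mathfrak f(w)=\sum_{n\ge1}a_{-n}w^n$ is an arithmetic Gevrey series of order $1$; put $\Psi_\theta(z)=F(z)+\mathfrak f_\theta(1/z)$, the anti-Stokes directions of $\Psi$ being those of $\mathfrak f$. Let $\mathbf E$ be the set of values of $E$-functions at algebraic points, $\mathbf D$ the set of values $\mathfrak f_\theta(1)$ of arithmetic Gevrey series $\mathfrak f$ of order $1$, and $\mathbf M_G$ the set of values $\Psi_\theta(1)$ of mixed functions $\Psi$, where in both cases $\theta=0$ if $0$ is not an anti-Stokes direction, and $\theta>0$ is sufficiently small otherwise. For $a\in\mathbb Q$, $a>0$, and an integer $s\ge0$ put $$E_{a,s+1}(z)=\sum_{n=0}^\infty\frac{z^n}{n!(n+a)^{s+1}},\qquad \mathfrak f_{a,s+1}(z)=\sum_{n=0}^\infty n!\,u_{a,s,n}z^n,\quad\text{where } (1+x)^{a-1}\log(1+x)^s=\sum_{n=0}^\infty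 u_{a,s,n}x^n .$$ Proposition. One has $\mathbf M_G=\mathbf E+\mathbf D$. For every integer $s\ge0$ and every rational $a>0$, $$\Gamma^{(s)}(a)\in e^{-1}\mathbf M_G=e^{-1}(\mathbf E+\mathbf D).$$ Moreover $E_{a,s+1}$ is an $E$-function, $\mathfrak f_{a,s+1}$ is an arithmetic Gevrey series of order $1$, $0$ is not an anti-Stokes direction of $\mathfrak f_{a,s+1}$, the $1$-sum of $\mathfrak f_{a,s+1}$ in the direction $0$ satisfies $\mathfrak f_{a,s+1;0}(1)=\int_0^\infty(1+t)^{a-1}\log(1+t)^s e^{-t}\,dt$, and $$\Gamma^{(s)}(a)=(-1)^s s!\,E_{a,s+1}(-1)+e^{-1}\mathfrak f_{a,s+1;0}(1).$$ -/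

import Mathlib

open scoped PowerSeries Pointwise Topology

noncomputable section

/-- The field of algebraic numbers, embedded in `ℂ`. -/
abbrev Qbar : Type := ↥(algebraicClosure ℚ ℂ)

/-- `F` is holonomic: it is a solution of a non-zero linear differential equation
`p_r F^(r) + ... + p_1 F' + p_0 F = 0` whose coefficients are polynomials over `Qbar`
(equivalently, rational functions, after clearing denominators). -/
def IsHolonomic (F : Qbar⟦X⟧) : Prop :=
  ∃ (r : ℕ) (p : ℕ → Polynomial Qbar), p r ≠ 0 ∧
    ∑ i ∈ Finset.range (r + 1),
      (p i : Qbar⟦X⟧) * (⇑(PowerSeries.derivative Qbar))^[i] F = 0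

/-- The absolute values of all Galois conjugates of `a n` grow at most exponentially in `n`. -/
def ConjugatesGrowAtMostExp (a : ℕ → Qbar) : Prop :=
  ∃ C : ℝ, 0 < C ∧ ∀ (σ : Qbar ≃ₐ[ℚ] Qbar) (n : ℕ), ‖((σ (a n) : Qbar) : ℂ)‖ ≤ C ^ (n + 1)

/-- The least common denominator of `a 0, ..., a n` (the least positive integer `d` such that
all `d * a k`, `k ≤ n`, are algebraic integers) grows at most exponentially in `n`. -/
def DenominatorsGrowAtMostExp (a : ℕ → Qbar) : Prop :=
  ∃ D : ℕ, 0 < D ∧ ∀ n : ℕ, ∃ d : ℕ, 0 < d ∧ d ≤ D ^ (n + 1) ∧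
    ∀ k ≤ n, IsIntegral ℤ ((d : Qbar) * a k)

/-- `F = ∑ (a n / n!) x ^ n` is an `E`-function. -/
def IsEFunction (F : Qbar⟦X⟧) : Prop :=
  IsHolonomic F ∧
    ConjugatesGrowAtMostExp (fun n => (n.factorial : Qbar) * PowerSeries.coeff n F) ∧
    DenominatorsGrowAtMostExp (fun n => (n.factorial : Qbar) * PowerSeries.coeff n F)

/-- `∑ a n x ^ n` is a `G`-function when `∑ (a n / n!) x ^ n` is an `E`-function. -/
def IsGFunction (G : Qbar⟦X⟧) : Prop :=
  IsEFunction (PowerSeries.mk fun n => PowerSeries.coeff n G / (n.factorial : Qbar))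

/-- The formal Borel transform `∑ c n z ^ n ↦ ∑ (c n / n!) x ^ n`. -/
def borelTransform (f : Qbar⟦X⟧) : Qbar⟦X⟧ :=
  PowerSeries.mk fun n => PowerSeries.coeff n f / (n.factorial : Qbar)

/-- Arithmetic Gevrey series of order `1`: the series `∑ n! a n z ^ n`
such that `∑ a n x ^ n` is a `G`-function. -/
def IsAntieFunction (f : Qbar⟦X⟧) : Prop :=
  IsGFunction (borelTransform f)

/-- `w` is the (complex) sum of the convergent series `F(z)`. -/
def HasValueAt (F : Qbar⟦X⟧) (z w : ℂ) : Prop :=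
  HasSum (fun n : ℕ => ((PowerSeries.coeff n F : Qbar) : ℂ) * z ^ n) w

/-- The open sector, of half-opening `ε`, around the ray `arg x = -θ`. -/
def sectorAround (θ ε : ℝ) : Set ℂ :=
  {x : ℂ | x ≠ 0 ∧ |Complex.arg (x * Complex.exp (θ * Complex.I))| < ε}

/-- `B` is a holomorphic continuation of the Borel transform of `f` to a neighbourhood of
`0` together with an open sector around the ray `arg x = -θ`, with growth at most
`exp (K |x|)` on the sector for every `K > 0`. The direction `θ` refers to the variable `z`
in `f(1/z)`, hence the ray `arg x = -θ` in the Borel plane. That every `K > 0` is allowed means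
that the `1`-sum of `f(1/z)` is holomorphic at all `z ≠ 0` of a large sector bisected by `θ`. -/
def IsBorelContinuation (f : Qbar⟦X⟧) (θ : ℝ) (B : ℂ → ℂ) : Prop :=
  ∃ ε : ℝ, 0 < ε ∧
    DifferentiableOn ℂ B (Metric.ball 0 ε ∪ sectorAround θ ε) ∧
    (∀ x ∈ Metric.ball (0 : ℂ) ε, HasValueAt (borelTransform f) x (B x)) ∧
    ∀ K : ℝ, 0 < K → ∃ C : ℝ, ∀ x ∈ sectorAround θ ε, ‖B x‖ ≤ C * Real.exp (K * ‖x‖)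

/-- `θ` is an anti-Stokes direction of `f(1/z)`: the series is not `1`-summable in the
direction `θ`. -/
def IsAntiStokes (f : Qbar⟦X⟧) (θ : ℝ) : Prop :=
  ¬ ∃ B : ℂ → ℂ, IsBorelContinuation f θ B

/-- `θ` is not anti-Stokes for `f`, and the `1`-sum (Borel-Laplace sum) of `f(1/z)` in the
direction `θ`, evaluated at a point `z` of the half-plane bisected by `θ`, is
`w = z ∫ B(x) exp (-x z) dx`, the integral being along the ray `arg x = -θ`. -/
def HasOneSumAt (f : Qbar⟦X⟧) (θ : ℝ) (z w : ℂ) : Prop :=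
  0 < (z * Complex.exp (-(θ * Complex.I))).re ∧
  ∃ B : ℂ → ℂ, IsBorelContinuation f θ B ∧
    w = z * ∫ t in Set.Ioi (0 : ℝ),
      B (t * Complex.exp (-(θ * Complex.I))) *
        Complex.exp (-(t * Complex.exp (-(θ * Complex.I)) * z)) *
        Complex.exp (-(θ * Complex.I))

/-- The ring `E` of all values of `E`-functions at algebraic points. -/
def valuesE : Set ℂ :=
  {w | ∃ F : Qbar⟦X⟧, IsEFunction F ∧ ∃ ξ : Qbar, HasValueAt F (ξ : ℂ) w}

/-- The ring `D` of all `f_θ(1)`, where `f` is an arithmetic Gevrey series of order `1`, with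
`θ = 0` if it is not an anti-Stokes direction, and `θ > 0` sufficiently small otherwise. -/
def valuesD : Set ℂ :=
  {w | ∃ f : Qbar⟦X⟧, IsAntieFunction f ∧
    ((¬ IsAntiStokes f 0 ∧ HasOneSumAt f 0 1 w) ∨
      (IsAntiStokes f 0 ∧ ∀ᶠ θ : ℝ in 𝓝[>] 0, HasOneSumAt f θ 1 w))}

/-- The part `∑_{n ≥ 0} a n z ^ n` of a formal series `∑_{n ∈ ℤ} a n z ^ n`. -/
def plusPart (Ψ : ℤ → Qbar) : Qbar⟦X⟧ :=
  PowerSeries.mk fun n => Ψ n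

/-- The part `∑_{n ≥ 1} a (-n) z ^ (-n)` of a formal series `∑_{n ∈ ℤ} a n z ^ n`, as a power
series in `1/z`. -/
def minusPart (Ψ : ℤ → Qbar) : Qbar⟦X⟧ :=
  PowerSeries.mk fun n => if n = 0 then 0 else Ψ (-(n : ℤ))

/-- Mixed (arithmetic Gevrey) functions: formal series `∑_{n ∈ ℤ} Ψ n z ^ n`. -/
def IsMixedFunction (Ψ : ℤ → Qbar) : Prop :=
  IsEFunction (plusPart Ψ) ∧ IsAntieFunction (minusPart Ψ)

/-- `Ψ_θ(z) = w`, where `Ψ_θ(z) = F(z) + f_θ(1/z)` for `Ψ = F(z) + f(1/z)`. -/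
def MixedHasValueAt (Ψ : ℤ → Qbar) (θ : ℝ) (z w : ℂ) : Prop :=
  ∃ u v : ℂ, HasValueAt (plusPart Ψ) z u ∧ HasOneSumAt (minusPart Ψ) θ z v ∧ w = u + v

/-- The set `M_G` of values `Ψ_θ(1)` of mixed functions, with `θ = 0` if it is not an
anti-Stokes direction of `Ψ`, and `θ > 0` sufficiently small otherwise. -/
def valuesMixed : Set ℂ :=
  {w | ∃ Ψ : ℤ → Qbar, IsMixedFunction Ψ ∧
    ((¬ IsAntiStokes (minusPart Ψ) 0 ∧ MixedHasValueAt Ψ 0 1 w) ∨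
      (IsAntiStokes (minusPart Ψ) 0 ∧ ∀ᶠ θ : ℝ in 𝓝[>] 0, MixedHasValueAt Ψ θ 1 w))}

/-- The series `E_{a,s}(z) = ∑ z ^ n / (n! (n + a) ^ s)`. -/
def seriesE (a : ℚ) (s : ℕ) : Qbar⟦X⟧ :=
  PowerSeries.mk fun n => 1 / ((n.factorial : Qbar) * ((n : Qbar) + (a : Qbar)) ^ s)

/-- The series `f_{a,k+1}(z) = ∑ n! u_{a,k,n} z ^ n`, where
`(1 + x) ^ (a - 1) log (1 + x) ^ k = ∑ u_{a,k,n} x ^ n`. -/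
def seriesAntie (a : ℚ) (k : ℕ) : Qbar⟦X⟧ :=
  PowerSeries.mk fun n => (n.factorial : Qbar) *
    PowerSeries.coeff n
      (PowerSeries.binomialSeries Qbar (a - 1) * PowerSeries.log Qbar ^ k)

end

/-!
Holonomic series are those lying in a finitely generated module over the polynomials that is stable
under `d/dx` up to polynomial factors, and such modules can be added and multiplied; this gives the
differential equations of sums and products. The arithmetic conditions come from
`lcm (1, ..., n) ≤ D ^ n` and from the integrality of `d ^ (2 n) * choose α n`, where `d` is the
denominator of `α`. The Borel transform of `f_{a,s+1}` is `(1 + x) ^ (a - 1) * log (1 + x) ^ s`; it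
is holomorphic off `(-∞, -1]` and grows polynomially, so that `0` is not an anti-Stokes direction.

A mixed function has no constant term in its Gevrey part, whereas an element of `D` may come from
a series with a constant term; as `E`-functions absorb constants, this does not change `E + D`.

Finally `Γ^(s)(a) = ∫_0^∞ t ^ (a - 1) * log t ^ s * exp (-t) dt` is cut at `t = 1`. On `(0, 1]` one
expands `exp (-t)` and integrates termwise, the integral of `t ^ (z - 1) * log t ^ s` over `(0, 1]`
being the `s`-th derivative `(-1) ^ s * s! / z ^ (s + 1)` of `1 / z`. On `(1, ∞)` the substitution
`t ↦ 1 + t` produces `exp (-1)` times the Laplace integral of the Borel transform above.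
-/

section QuasiStable

open scoped Polynomial

variable {R : Type*} [CommRing R]

theorem polynomial_smul_eq_coe_mul (q : R[X]) (F : R⟦X⟧) : q • F = (q : R⟦X⟧) * F := by
  rw [Algebra.smul_def, PowerSeries.algebraMap_apply']
  simp

theorem derivative_polynomial_smul (q : R[X]) (F : R⟦X⟧) :
    PowerSeries.derivative R (q • F) =
      Polynomial.derivative q • F + q • PowerSeries.derivative R F := by
  simp only [polynomial_smul_eq_coe_mul, Derivation.leibniz, smul_eq_mul,
    PowerSeries.derivative_coe]
  ring

/-- A module of power series over the polynomials is quasi-stable if it is stable under `d/dx` up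
to non-zero polynomial factors, that is, if its span over the rational functions is stable under
`d/dx`. Elements of finitely generated quasi-stable modules are the solutions of linear
differential equations. -/
def IsQuasiStable (V : Submodule R[X] R⟦X⟧) : Prop :=
  ∀ F ∈ V, ∃ q : R[X], q ≠ 0 ∧ q • PowerSeries.derivative R F ∈ V

variable [IsDomain R] {V W : Submodule R[X] R⟦X⟧} {F : R⟦X⟧}

theorem isQuasiStable_span {S : Set R⟦X⟧}
    (hS : ∀ F ∈ S, ∃ q : R[X], q ≠ 0 ∧
      q • PowerSeries.derivative R F ∈ Submodule.span R[X] S) :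
    IsQuasiStable (Submodule.span R[X] S) := by
  intro F hF
  induction hF using Submodule.span_induction with
  | mem F hF => exact hS F hF
  | zero => exact ⟨1, one_ne_zero, by simp⟩
  | add F G _ _ ihF ihG =>
    obtain ⟨p, hp, hpF⟩ := ihF
    obtain ⟨q, hq, hqG⟩ := ihG
    refine ⟨p * q, mul_ne_zero hp hq, ?_⟩
    rw [map_add, smul_add, mul_comm, mul_smul, mul_comm, mul_smul]
    exact add_mem (Submodule.smul_mem _ _ hpF) (Submodule.smul_mem _ _ hqG)
  | smul p F hF ih =>
    obtain ⟨q, hq, hqF⟩ := ih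
    refine ⟨q, hq, ?_⟩
    rw [derivative_polynomial_smul, smul_add, smul_comm q p]
    exact add_mem (Submodule.smul_mem _ _ (Submodule.smul_mem _ _ hF))
      (Submodule.smul_mem _ _ hqF)

theorem IsQuasiStable.sup (hV : IsQuasiStable V) (hW : IsQuasiStable W) :
    IsQuasiStable (V ⊔ W) := by
  rw [← V.span_eq, ← W.span_eq, ← Submodule.span_union]
  refine isQuasiStable_span ?_
  rintro F (hF | hF)
  · obtain ⟨q, hq, hqF⟩ := hV F hF
    exact ⟨q, hq, Submodule.subset_span (Or.inl hqF)⟩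
  · obtain ⟨q, hq, hqF⟩ := hW F hF
    exact ⟨q, hq, Submodule.subset_span (Or.inr hqF)⟩

theorem IsQuasiStable.mul (hV : IsQuasiStable V) (hW : IsQuasiStable W) :
    IsQuasiStable (V * W) := by
  rw [Submodule.mul_eq_span_mul_set]
  refine isQuasiStable_span ?_
  rw [← Submodule.mul_eq_span_mul_set]
  rintro _ ⟨F, hF, G, hG, rfl⟩
  obtain ⟨p, hp, hpF⟩ := hV F hF
  obtain ⟨q, hq, hqG⟩ := hW G hG
  refine ⟨p * q, mul_ne_zero hp hq, ?_⟩
  have leibniz : (p * q) • PowerSeries.derivative R (F * G) =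
      (p • F) * (q • PowerSeries.derivative R G) +
        (p • PowerSeries.derivative R F) * (q • G) := by
    simp only [polynomial_smul_eq_coe_mul, Derivation.leibniz, smul_eq_mul, Polynomial.coe_mul]
    ring
  rw [leibniz]
  exact add_mem (Submodule.mul_mem_mul (V.smul_mem _ hF) hqG)
    (Submodule.mul_mem_mul hpF (W.smul_mem _ hG))

theorem IsQuasiStable.exists_smul_iterate_derivative_mem (hV : IsQuasiStable V) (hF : F ∈ V)
    (k : ℕ) : ∃ q : R[X], q ≠ 0 ∧ q • (⇑(PowerSeries.derivative R))^[k] F ∈ V := by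
  induction k with
  | zero => exact ⟨1, one_ne_zero, by simpa using hF⟩
  | succ k ih =>
    obtain ⟨q, hq, hqF⟩ := ih
    obtain ⟨p, hp, hpF⟩ := hV _ hqF
    refine ⟨p * q * q, mul_ne_zero (mul_ne_zero hp hq) hq, ?_⟩
    rw [Function.iterate_succ_apply']
    convert sub_mem (V.smul_mem q hpF) (V.smul_mem (p * Polynomial.derivative q) hqF) using 1
    rw [derivative_polynomial_smul]
    module

theorem IsQuasiStable.not_linearIndependent_iterate_derivative (hV : IsQuasiStable V)
    (hfg : V.FG) (hF : F ∈ V) :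
    ¬ LinearIndependent R[X] fun k => (⇑(PowerSeries.derivative R))^[k] F := by
  intro hli
  choose q hq hqF using hV.exists_smul_iterate_derivative_mem hF
  have hli' : LinearIndependent R[X] fun k => q k • (⇑(PowerSeries.derivative R))^[k] F := by
    rw [linearIndependent_iff'] at hli ⊢
    intro s g hg i hi
    have hgq := hli s (fun k => g k * q k) (by simpa only [mul_smul] using hg) i hi
    exact (mul_eq_zero.mp hgq).resolve_right (hq i)
  obtain ⟨S, hS, rfl⟩ := Submodule.fg_def.mp hfg
  have := hS.to_subtype
  have := hli'.finite_of_le_span_finite _ S (Set.range_subset_iff.mpr hqF)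
  exact not_finite ℕ

theorem IsQuasiStable.exists_sum_smul_iterate_derivative_eq_zero (hV : IsQuasiStable V)
    (hfg : V.FG) (hF : F ∈ V) : ∃ (r : ℕ) (p : ℕ → R[X]), p r ≠ 0 ∧
      ∑ i ∈ Finset.range (r + 1), p i • (⇑(PowerSeries.derivative R))^[i] F = 0 := by
  have hdep := hV.not_linearIndependent_iterate_derivative hfg hF
  rw [linearIndependent_iff] at hdep
  push Not at hdep
  obtain ⟨l, hl, hl0⟩ := hdep
  have hne := Finsupp.support_nonempty_iff.mpr hl0
  refine ⟨l.support.max' hne, l, Finsupp.mem_support_iff.mp (Finset.max'_mem _ _), ?_⟩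
  rw [← hl, Finsupp.linearCombination_apply, Finsupp.sum_of_support_subset l _ _ (by simp)]
  exact fun k hk => Finset.mem_range_succ_iff.mpr (Finset.le_max' _ _ hk)

theorem IsQuasiStable.sup_span_iterate_derivative (hV : IsQuasiStable V) {r : ℕ} {p : ℕ → R[X]}
    (hr : p r ≠ 0)
    (hF : ∑ i ∈ Finset.range (r + 1), p i • (⇑(PowerSeries.derivative R))^[i] F ∈ V) :
    IsQuasiStable (V ⊔ Submodule.span R[X]
      ((fun i => (⇑(PowerSeries.derivative R))^[i] F) '' Set.Iic r)) := by
  rw [← V.span_eq, ← Submodule.span_union]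
  set S := (fun i => (⇑(PowerSeries.derivative R))^[i] F) '' Set.Iic r
  have smul_mem (q : R[X]) {i : ℕ} (hi : i ≤ r) :
      q • (⇑(PowerSeries.derivative R))^[i] F ∈ Submodule.span R[X] (V ∪ S) :=
    Submodule.smul_mem _ _ (Submodule.subset_span (Or.inr ⟨i, hi, rfl⟩))
  refine isQuasiStable_span ?_
  rintro G (hG | ⟨i, hi, rfl⟩)
  · obtain ⟨q, hq, hqG⟩ := hV G hG
    exact ⟨q, hq, Submodule.subset_span (Or.inl hqG)⟩
  simp only [← Function.iterate_succ_apply' (⇑(PowerSeries.derivative R))]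
  rcases (Set.mem_Iic.mp hi).lt_or_eq with hlt | rfl
  · exact ⟨1, one_ne_zero, smul_mem 1 hlt⟩
  -- Differentiating the given relation expresses `p i • D^(i+1) F` through lower derivatives.
  obtain ⟨q, hq, hqF⟩ := hV _ hF
  refine ⟨q * p i, mul_ne_zero hq hr, ?_⟩
  simp only [map_sum, derivative_polynomial_smul, smul_add, Finset.sum_add_distrib,
    Finset.smul_sum, ← Function.iterate_succ_apply' (⇑(PowerSeries.derivative R)), smul_smul] at hqF
  rw [Finset.sum_range_succ (fun j => (q * p j) • _), ← add_assoc] at hqF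
  refine (add_mem_cancel_left (add_mem ?_ ?_)).mp (Submodule.subset_span (Or.inl hqF)) <;>
    refine sum_mem fun j hj => smul_mem _ ?_ <;> grind

end QuasiStable

section Holonomic

theorem IsHolonomic.of_mem {V : Submodule (Polynomial Qbar) Qbar⟦X⟧} (hV : IsQuasiStable V)
    (hfg : V.FG) {F : Qbar⟦X⟧} (hF : F ∈ V) : IsHolonomic F := by
  simpa only [IsHolonomic, polynomial_smul_eq_coe_mul] using
    hV.exists_sum_smul_iterate_derivative_eq_zero hfg hF

theorem exists_isQuasiStable_of_sum_mem {V : Submodule (Polynomial Qbar) Qbar⟦X⟧}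
    (hV : IsQuasiStable V) (hfg : V.FG) {F : Qbar⟦X⟧} {r : ℕ} {p : ℕ → Polynomial Qbar}
    (hr : p r ≠ 0)
    (hF : ∑ i ∈ Finset.range (r + 1),
      (p i : Qbar⟦X⟧) * (⇑(PowerSeries.derivative Qbar))^[i] F ∈ V) :
    ∃ W, IsQuasiStable W ∧ W.FG ∧ F ∈ W := by
  simp only [← polynomial_smul_eq_coe_mul] at hF
  refine ⟨_, hV.sup_span_iterate_derivative hr hF,
    hfg.sup (Submodule.fg_span ((Set.finite_Iic r).image _)), ?_⟩
  exact Submodule.mem_sup_right (Submodule.subset_span ⟨0, Nat.zero_le r, rfl⟩)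

theorem isHolonomic_iff_exists_isQuasiStable {F : Qbar⟦X⟧} :
    IsHolonomic F ↔ ∃ V, IsQuasiStable V ∧ V.FG ∧ F ∈ V := by
  refine ⟨fun ⟨r, p, hr, hF⟩ => ?_, fun ⟨V, hV, hfg, hF⟩ => .of_mem hV hfg hF⟩
  refine exists_isQuasiStable_of_sum_mem (V := ⊥) ?_ Submodule.fg_bot hr (by simp [hF])
  rintro _ rfl
  exact ⟨1, one_ne_zero, by simp⟩

variable {F G : Qbar⟦X⟧}

theorem IsHolonomic.of_sum_mul_iterate_derivative {r : ℕ} {p : ℕ → Polynomial Qbar}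
    (hr : p r ≠ 0)
    (hF : IsHolonomic (∑ i ∈ Finset.range (r + 1),
      (p i : Qbar⟦X⟧) * (⇑(PowerSeries.derivative Qbar))^[i] F)) : IsHolonomic F := by
  obtain ⟨V, hV, hfg, hFV⟩ := isHolonomic_iff_exists_isQuasiStable.mp hF
  exact isHolonomic_iff_exists_isQuasiStable.mpr (exists_isQuasiStable_of_sum_mem hV hfg hr hFV)

theorem IsHolonomic.add (hF : IsHolonomic F) (hG : IsHolonomic G) : IsHolonomic (F + G) := by
  obtain ⟨V, hV, hVfg, hFV⟩ := isHolonomic_iff_exists_isQuasiStable.mp hF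
  obtain ⟨W, hW, hWfg, hGW⟩ := isHolonomic_iff_exists_isQuasiStable.mp hG
  exact .of_mem (hV.sup hW) (hVfg.sup hWfg) (Submodule.add_mem_sup hFV hGW)

theorem IsHolonomic.mul (hF : IsHolonomic F) (hG : IsHolonomic G) : IsHolonomic (F * G) := by
  obtain ⟨V, hV, hVfg, hFV⟩ := isHolonomic_iff_exists_isQuasiStable.mp hF
  obtain ⟨W, hW, hWfg, hGW⟩ := isHolonomic_iff_exists_isQuasiStable.mp hG
  exact .of_mem (hV.mul hW) (hVfg.mul hWfg) (Submodule.mul_mem_mul hFV hGW)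

theorem isHolonomic_C (c : Qbar) : IsHolonomic (PowerSeries.C c) :=
  ⟨1, fun | 1 => 1 | _ => 0, one_ne_zero, by simp [Finset.sum_range_succ]⟩

theorem isHolonomic_of_derivative_eq_self (hF : PowerSeries.derivative Qbar F = F) :
    IsHolonomic F :=
  ⟨1, fun | 0 => -1 | _ => 1, one_ne_zero, by simp [Finset.sum_range_succ, hF]⟩

end Holonomic

section Rescale

variable {R : Type*} [CommRing R]

theorem iterate_derivative_rescale (ξ : R) (F : R⟦X⟧) (k : ℕ) :
    (⇑(PowerSeries.derivative R))^[k] (PowerSeries.rescale ξ F) =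
      PowerSeries.C (ξ ^ k) *
        PowerSeries.rescale ξ ((⇑(PowerSeries.derivative R))^[k] F) := by
  induction k with
  | zero => simp
  | succ k ih =>
    rw [Function.iterate_succ_apply', Function.iterate_succ_apply', ih]
    ext n
    rw [← PowerSeries.smul_eq_C_mul, ← PowerSeries.smul_eq_C_mul]
    simp only [PowerSeries.coeff_derivative, PowerSeries.coeff_rescale, PowerSeries.coeff_smul,
      smul_eq_mul]
    ring

theorem rescale_polynomial_coe (ξ : R) (p : Polynomial R) :
    PowerSeries.rescale ξ (p : R⟦X⟧) =
      ((p.comp (Polynomial.C ξ * Polynomial.X) : Polynomial R) : R⟦X⟧) := by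
  ext n
  rw [PowerSeries.coeff_rescale, Polynomial.coeff_coe, Polynomial.coeff_coe,
    Polynomial.comp_C_mul_X_coeff, mul_comm]

theorem IsHolonomic.rescale {F : Qbar⟦X⟧} (hF : IsHolonomic F) (ξ : Qbar) :
    IsHolonomic (PowerSeries.rescale ξ F) := by
  rcases eq_or_ne ξ 0 with rfl | hξ
  · rw [PowerSeries.rescale_zero_apply]
    exact isHolonomic_C _
  obtain ⟨r, p, hr, hF⟩ := hF
  refine ⟨r, fun i => Polynomial.C (ξ⁻¹ ^ i) * (p i).comp (Polynomial.C ξ * Polynomial.X),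
    mul_ne_zero (by simp [hξ]) ?_, ?_⟩
  · rwa [Ne, Polynomial.comp_C_mul_X_eq_zero_iff (mem_nonZeroDivisors_of_ne_zero hξ)]
  rw [← map_zero (PowerSeries.rescale ξ), ← hF, map_sum]
  refine Finset.sum_congr rfl fun i _ => ?_
  rw [iterate_derivative_rescale, map_mul, rescale_polynomial_coe, Polynomial.coe_mul,
    Polynomial.coe_C, mul_mul_mul_comm, ← map_mul, ← mul_pow, inv_mul_cancel₀ hξ]
  simp

end Rescale

section BinomialSeries

variable {R : Type*} [CommRing R] [BinomialRing R]

theorem factorial_mul_choose_eq_prod (r : R) (n : ℕ) :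
    (n.factorial : R) * Ring.choose r n = ∏ i ∈ Finset.range n, (r - i) := by
  rw [← nsmul_eq_mul, ← Ring.descPochhammer_eq_factorial_smul_choose]
  induction n with
  | zero => simp
  | succ n ih =>
    rw [descPochhammer_succ_right, Polynomial.smeval_mul, ih, Finset.prod_range_succ,
      Polynomial.smeval_sub, Polynomial.smeval_X, Polynomial.smeval_natCast]
    simp

theorem succ_mul_choose_succ (r : R) (n : ℕ) :
    ((n : R) + 1) * Ring.choose r (n + 1) = (r - n) * Ring.choose r n := by
  have := BinomialRing.toIsAddTorsionFree (R := R)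
  refine nsmul_right_injective n.factorial_ne_zero ?_
  have h := factorial_mul_choose_eq_prod r (n + 1)
  rw [Finset.prod_range_succ, ← factorial_mul_choose_eq_prod, Nat.factorial_succ] at h
  push_cast at h
  simp only [nsmul_eq_mul]
  linear_combination h

variable {A : Type*} [CommRing A]

theorem one_add_X_mul_derivative_binomialSeries [Algebra R A] (r : R) :
    (1 + PowerSeries.X) * PowerSeries.derivative A (PowerSeries.binomialSeries A r) =
      PowerSeries.C (algebraMap R A r) * PowerSeries.binomialSeries A r := by
  ext n
  have h := congrArg (algebraMap R A) (succ_mul_choose_succ r n)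
  simp only [map_mul, map_add, map_sub, map_natCast, map_one] at h
  rw [add_mul, one_mul, map_add, PowerSeries.coeff_C_mul]
  cases n with
  | zero => simp [PowerSeries.coeff_derivative, Algebra.smul_def]
  | succ n =>
    rw [PowerSeries.coeff_succ_X_mul]
    simp only [PowerSeries.coeff_derivative, PowerSeries.binomialSeries_coeff, Algebra.smul_def]
    push_cast at h ⊢
    linear_combination h

theorem one_add_X_mul_derivative_log [Algebra ℚ A] :
    (1 + PowerSeries.X) * PowerSeries.derivative A (PowerSeries.log A) = 1 := by
  rw [PowerSeries.deriv_log]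
  ext n
  rw [add_mul, one_mul, map_add]
  cases n with
  | zero => simp
  | succ n =>
    rw [PowerSeries.coeff_succ_X_mul]
    simp [pow_succ, PowerSeries.coeff_one]

/-- The series `(1 + x) ^ α log (1 + x) ^ k`. -/
noncomputable def binomialLogSeries (α : ℚ) (k : ℕ) : Qbar⟦X⟧ :=
  PowerSeries.binomialSeries Qbar α * PowerSeries.log Qbar ^ k

theorem one_add_X_mul_derivative_binomialLogSeries (α : ℚ) (k : ℕ) :
    (1 + PowerSeries.X) * PowerSeries.derivative Qbar (binomialLogSeries α k) =
      PowerSeries.C (α : Qbar) * binomialLogSeries α k +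
        PowerSeries.C (k : Qbar) * binomialLogSeries α (k - 1) := by
  have hbinomial := one_add_X_mul_derivative_binomialSeries (A := Qbar) α
  have hlog := one_add_X_mul_derivative_log (A := Qbar)
  simp only [binomialLogSeries, Derivation.leibniz, Derivation.leibniz_pow, smul_eq_mul,
    nsmul_eq_mul, map_natCast, eq_ratCast] at hbinomial hlog ⊢
  linear_combination (PowerSeries.log Qbar ^ k) * hbinomial +
    (PowerSeries.binomialSeries Qbar α) * k * PowerSeries.log Qbar ^ (k - 1) * hlog

end BinomialSeries

section BorelTransform

theorem borelTransform_add (F G : Qbar⟦X⟧) :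
    borelTransform (F + G) = borelTransform F + borelTransform G := by
  ext n : 1
  simp [borelTransform, add_div]

theorem borelTransform_C_mul (c : Qbar) (F : Qbar⟦X⟧) :
    borelTransform (PowerSeries.C c * F) = PowerSeries.C c * borelTransform F := by
  ext n : 1
  simp [borelTransform, mul_div_assoc]

theorem borelTransform_C (c : Qbar) : borelTransform (PowerSeries.C c) = PowerSeries.C c := by
  ext n : 1
  rcases eq_or_ne n 0 with rfl | hn <;> simp [borelTransform, PowerSeries.coeff_C, *]

theorem factorial_mul_coeff_borelTransform (F : Qbar⟦X⟧) (n : ℕ) :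
    (n.factorial : Qbar) * PowerSeries.coeff n (borelTransform F) = PowerSeries.coeff n F := by
  rw [borelTransform, PowerSeries.coeff_mk]
  exact mul_div_cancel₀ _ (by exact_mod_cast n.factorial_ne_zero)

theorem derivative_borelTransform_X_mul (F : Qbar⟦X⟧) :
    PowerSeries.derivative Qbar (borelTransform (PowerSeries.X * F)) = borelTransform F := by
  ext n
  rw [PowerSeries.coeff_derivative, borelTransform, PowerSeries.coeff_mk,
    PowerSeries.coeff_succ_X_mul, borelTransform, PowerSeries.coeff_mk, Nat.factorial_succ]
  push_cast
  have := n.cast_add_one_ne_zero (R := Qbar)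
  field_simp

theorem borelTransform_X_mul_derivative (F : Qbar⟦X⟧) :
    borelTransform (PowerSeries.X * PowerSeries.derivative Qbar F) =
      PowerSeries.X * PowerSeries.derivative Qbar (borelTransform F) := by
  ext n
  cases n with
  | zero => simp [borelTransform]
  | succ n =>
    simp only [borelTransform, PowerSeries.coeff_mk, PowerSeries.coeff_succ_X_mul,
      PowerSeries.coeff_derivative]
    exact mul_div_right_comm _ _ _

theorem borelTransform_derivative (F : Qbar⟦X⟧) :
    borelTransform (PowerSeries.derivative Qbar F) = PowerSeries.derivative Qbar
      (PowerSeries.X * PowerSeries.derivative Qbar (borelTransform F)) := by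
  rw [← borelTransform_X_mul_derivative, derivative_borelTransform_X_mul]

theorem isHolonomic_borelTransform_binomialLogSeries (α : ℚ) (k : ℕ) :
    IsHolonomic (borelTransform (binomialLogSeries α k)) := by
  have hborel (k : ℕ) :=
    congrArg borelTransform (one_add_X_mul_derivative_binomialLogSeries α k)
  simp only [add_mul, one_mul, borelTransform_add, borelTransform_derivative,
    borelTransform_X_mul_derivative, borelTransform_C_mul, Derivation.leibniz, smul_eq_mul,
    PowerSeries.derivative_X, mul_one] at hborel
  have of_predecessor (k : ℕ) :
      IsHolonomic (PowerSeries.C (k : Qbar) * borelTransform (binomialLogSeries α (k - 1))) →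
      IsHolonomic (borelTransform (binomialLogSeries α k)) := by
    intro h
    refine .of_sum_mul_iterate_derivative (r := 2)
      (p := fun | 0 => -Polynomial.C (α : Qbar) | 1 => 1 + Polynomial.X | _ => Polynomial.X)
      Polynomial.X_ne_zero ?_
    convert h using 1
    simp only [Finset.sum_range_succ, Finset.range_zero, Finset.sum_empty, Function.iterate_succ,
      Function.iterate_zero, Function.comp_apply, id_eq, Polynomial.coe_C, Polynomial.coe_X,
      Polynomial.coe_add, Polynomial.coe_one, Polynomial.coe_neg]
    linear_combination hborel k
  induction k with
  | zero => exact of_predecessor 0 (by simpa using isHolonomic_C 0)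
  | succ k ih => exact of_predecessor (k + 1) ((isHolonomic_C _).mul ih)

end BorelTransform

section SeriesE

theorem derivative_seriesE_zero (a : ℚ) :
    PowerSeries.derivative Qbar (seriesE a 0) = seriesE a 0 := by
  ext n : 1
  simp only [PowerSeries.coeff_derivative, seriesE, PowerSeries.coeff_mk, pow_zero, mul_one,
    Nat.factorial_succ]
  have := n.cast_add_one_ne_zero (R := Qbar)
  push_cast
  field_simp

variable {a : ℚ}

theorem X_mul_derivative_seriesE_succ (ha : ∀ n : ℕ, (n : ℚ) + a ≠ 0) (s : ℕ) :
    PowerSeries.X * PowerSeries.derivative Qbar (seriesE a (s + 1)) =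
      seriesE a s - PowerSeries.C (a : Qbar) * seriesE a (s + 1) := by
  ext n : 1
  have hna : (n : Qbar) + a ≠ 0 := by exact_mod_cast ha n
  have hn : (n.factorial : Qbar) ≠ 0 := by exact_mod_cast n.factorial_ne_zero
  have hX : PowerSeries.coeff n
      (PowerSeries.X * PowerSeries.derivative Qbar (seriesE a (s + 1))) =
      n * PowerSeries.coeff n (seriesE a (s + 1)) := by
    cases n with
    | zero => simp
    | succ n =>
      rw [PowerSeries.coeff_succ_X_mul, PowerSeries.coeff_derivative]
      push_cast
      ring
  rw [hX, map_sub, PowerSeries.coeff_C_mul]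
  simp only [seriesE, PowerSeries.coeff_mk]
  field_simp
  ring

theorem isHolonomic_seriesE (ha : ∀ n : ℕ, (n : ℚ) + a ≠ 0) (s : ℕ) :
    IsHolonomic (seriesE a s) := by
  induction s with
  | zero => exact isHolonomic_of_derivative_eq_self (derivative_seriesE_zero a)
  | succ s ih =>
    refine .of_sum_mul_iterate_derivative (r := 1)
      (p := fun | 0 => Polynomial.C (a : Qbar) | _ => Polynomial.X) Polynomial.X_ne_zero ?_
    simpa [Finset.sum_range_succ, X_mul_derivative_seriesE_succ ha] using ih

end SeriesE

section ArithmeticGrowth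

open Finset.HasAntidiagonal

variable {a b : ℕ → Qbar}

/-- The two growth conditions shared by the coefficients of `G`-functions and the numbers
`n! a n` attached to `E`-functions `∑ a n z ^ n`. -/
def HasArithmeticGrowth (a : ℕ → Qbar) : Prop :=
  ConjugatesGrowAtMostExp a ∧ DenominatorsGrowAtMostExp a

theorem ConjugatesGrowAtMostExp.exists_forall_le (ha : ConjugatesGrowAtMostExp a) :
    ∃ C : ℝ, 0 < C ∧ ∀ (σ : Qbar ≃ₐ[ℚ] Qbar) (k n : ℕ), k ≤ n →
      ‖((σ (a k) : Qbar) : ℂ)‖ ≤ C ^ (n + 1) := by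
  obtain ⟨C, hC, ha⟩ := ha
  refine ⟨max C 1, by positivity, fun σ k n hkn => (ha σ k).trans ?_⟩
  calc C ^ (k + 1) ≤ max C 1 ^ (k + 1) := by gcongr; exact le_max_left _ _
    _ ≤ max C 1 ^ (n + 1) := pow_le_pow_right₀ (le_max_right _ _) (by omega)

theorem ConjugatesGrowAtMostExp.sum_mul (ha : ConjugatesGrowAtMostExp a)
    (hb : ConjugatesGrowAtMostExp b) {t : ℕ → Finset (ℕ × ℕ)} {w : ℕ × ℕ → ℕ} {K : ℕ}
    (ht : ∀ n, ∀ p ∈ t n, p.1 ≤ n ∧ p.2 ≤ n) (hw : ∀ n, ∑ p ∈ t n, w p ≤ K ^ (n + 1)) :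
    ConjugatesGrowAtMostExp fun n => ∑ p ∈ t n, (w p : Qbar) * (a p.1 * b p.2) := by
  obtain ⟨A, hA, ha⟩ := ha.exists_forall_le
  obtain ⟨B, hB, hb⟩ := hb.exists_forall_le
  refine ⟨(K + 1) * (A * B), by positivity, fun σ n => ?_⟩
  have hterm : ∀ p ∈ t n, ‖((σ ((w p : Qbar) * (a p.1 * b p.2)) : Qbar) : ℂ)‖ ≤
      w p * (A * B) ^ (n + 1) := by
    intro p hp
    rw [map_mul, map_mul, map_natCast, mul_pow]
    push_cast
    rw [norm_mul, norm_mul, Complex.norm_natCast]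
    gcongr
    · exact ha σ _ _ (ht n p hp).1
    · exact hb σ _ _ (ht n p hp).2
  rw [map_sum, AddSubmonoidClass.coe_finsetSum]
  calc ‖∑ p ∈ t n, ((σ ((w p : Qbar) * (a p.1 * b p.2)) : Qbar) : ℂ)‖
      ≤ ∑ p ∈ t n, w p * (A * B) ^ (n + 1) := norm_sum_le_of_le _ hterm
    _ = (∑ p ∈ t n, w p : ℕ) * (A * B) ^ (n + 1) := by rw [← Finset.sum_mul, Nat.cast_sum]
    _ ≤ (K + 1) ^ (n + 1) * (A * B) ^ (n + 1) := by
        gcongr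
        exact_mod_cast (hw n).trans (Nat.pow_le_pow_left K.le_succ _)
    _ = ((K + 1) * (A * B)) ^ (n + 1) := (mul_pow _ _ _).symm

theorem DenominatorsGrowAtMostExp.sum_mul (ha : DenominatorsGrowAtMostExp a)
    (hb : DenominatorsGrowAtMostExp b) {t : ℕ → Finset (ℕ × ℕ)} (w : ℕ × ℕ → ℕ)
    (ht : ∀ n, ∀ p ∈ t n, p.1 ≤ n ∧ p.2 ≤ n) :
    DenominatorsGrowAtMostExp fun n => ∑ p ∈ t n, (w p : Qbar) * (a p.1 * b p.2) := by
  obtain ⟨A, hA, ha⟩ := ha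
  obtain ⟨B, hB, hb⟩ := hb
  refine ⟨A * B, by positivity, fun n => ?_⟩
  obtain ⟨d, hd, hdA, hda⟩ := ha n
  obtain ⟨e, he, heB, heb⟩ := hb n
  refine ⟨d * e, by positivity, by rw [mul_pow]; gcongr, fun k hk => ?_⟩
  rw [Finset.mul_sum]
  refine IsIntegral.sum _ fun p hp => ?_
  obtain ⟨hp₁, hp₂⟩ := ht k p hp
  convert (isIntegral_natCast (w p)).mul
    ((hda p.1 (hp₁.trans hk)).mul (heb p.2 (hp₂.trans hk))) using 1
  push_cast
  ring

theorem HasArithmeticGrowth.sum_mul (ha : HasArithmeticGrowth a) (hb : HasArithmeticGrowth b)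
    {t : ℕ → Finset (ℕ × ℕ)} {w : ℕ × ℕ → ℕ} {K : ℕ}
    (ht : ∀ n, ∀ p ∈ t n, p.1 ≤ n ∧ p.2 ≤ n) (hw : ∀ n, ∑ p ∈ t n, w p ≤ K ^ (n + 1)) :
    HasArithmeticGrowth fun n => ∑ p ∈ t n, (w p : Qbar) * (a p.1 * b p.2) :=
  ⟨ha.1.sum_mul hb.1 ht hw, ha.2.sum_mul hb.2 w ht⟩

theorem HasArithmeticGrowth.mul (ha : HasArithmeticGrowth a) (hb : HasArithmeticGrowth b) :
    HasArithmeticGrowth fun n => a n * b n := by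
  simpa using ha.sum_mul hb (t := fun n => {(n, n)}) (w := 1) (K := 1) (by simp) (by simp)

theorem HasArithmeticGrowth.antidiagonal_sum_mul (ha : HasArithmeticGrowth a)
    (hb : HasArithmeticGrowth b) :
    HasArithmeticGrowth fun n =>
      ∑ p ∈ antidiagonal n, a p.1 * b p.2 := by
  simpa using ha.sum_mul hb (w := 1) (K := 2)
    (fun _ _ hp => ⟨antidiagonal.fst_le hp, antidiagonal.snd_le hp⟩)
    fun n => by simpa using (Nat.lt_two_pow_self (n := n + 1)).le

theorem HasArithmeticGrowth.antidiagonal_sum_choose_mul (ha : HasArithmeticGrowth a)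
    (hb : HasArithmeticGrowth b) :
    HasArithmeticGrowth fun n => ∑ p ∈ antidiagonal n,
      ((p.1 + p.2).choose p.1 : Qbar) * (a p.1 * b p.2) := by
  refine ha.sum_mul hb (w := fun p => (p.1 + p.2).choose p.1) (K := 2)
    (fun _ _ hp => ⟨antidiagonal.fst_le hp, antidiagonal.snd_le hp⟩) fun n => ?_
  rw [Finset.Nat.sum_antidiagonal_eq_sum_range_succ fun i j => (i + j).choose i,
    Finset.sum_congr rfl fun k hk => by
      rw [Nat.add_sub_cancel' (Finset.mem_range_succ_iff.mp hk)],
    Nat.sum_range_choose]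
  exact Nat.pow_le_pow_right two_pos n.le_succ

theorem HasArithmeticGrowth.add (ha : HasArithmeticGrowth a) (hb : HasArithmeticGrowth b) :
    HasArithmeticGrowth fun n => a n + b n := by
  obtain ⟨⟨A, hA, hconjA⟩, ⟨D, hD, hdenA⟩⟩ := ha
  obtain ⟨⟨B, hB, hconjB⟩, ⟨E, hE, hdenB⟩⟩ := hb
  refine ⟨⟨A + B, by positivity, fun σ n => ?_⟩, D * E, by positivity, fun n => ?_⟩
  · rw [map_add, AddMemClass.coe_add]
    exact (norm_add_le_of_le (hconjA σ n) (hconjB σ n)).trans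
      (pow_add_pow_le hA.le hB.le n.succ_ne_zero)
  · obtain ⟨d, hd, hdD, hda⟩ := hdenA n
    obtain ⟨e, he, heE, heb⟩ := hdenB n
    refine ⟨d * e, by positivity, by rw [mul_pow]; gcongr, fun k hk => ?_⟩
    have hsplit : ((d * e : ℕ) : Qbar) * (a k + b k) = e * (d * a k) + d * (e * b k) := by
      push_cast
      ring
    exact hsplit ▸ ((isIntegral_natCast e).mul (hda k hk)).add
      ((isIntegral_natCast d).mul (heb k hk))

theorem exists_norm_conjugates_le (x : Qbar) :
    ∃ M : ℝ, 1 ≤ M ∧ ∀ σ : Qbar ≃ₐ[ℚ] Qbar, ‖((σ x : Qbar) : ℂ)‖ ≤ M := by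
  have hx : IsIntegral ℚ x := (algebraicClosure.isAlgebraic ℚ ℂ).isIntegral.isIntegral x
  have hfin : ((minpoly ℚ x).rootSet Qbar).Finite := Polynomial.rootSet_finite _ _
  obtain ⟨M, hM⟩ := (hfin.image fun y : Qbar => ‖(y : ℂ)‖).bddAbove
  refine ⟨max M 1, le_max_right _ _, fun σ => (hM ⟨σ x, ?_, rfl⟩).trans (le_max_left _ _)⟩
  rw [Polynomial.mem_rootSet]
  refine ⟨minpoly.ne_zero hx, ?_⟩
  have hσ := Polynomial.aeval_algHom_apply (σ : Qbar →ₐ[ℚ] Qbar) x (minpoly ℚ x)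
  rwa [minpoly.aeval, map_zero] at hσ

theorem exists_natCast_mul_isIntegral (x : Qbar) :
    ∃ d : ℕ, 0 < d ∧ IsIntegral ℤ ((d : Qbar) * x) := by
  have hx : IsAlgebraic ℤ x :=
    (IsFractionRing.isAlgebraic_iff ℤ ℚ Qbar).mpr ((algebraicClosure.isAlgebraic ℚ ℂ).isAlgebraic x)
  obtain ⟨y, hy, hyx⟩ := hx.exists_integral_multiple
  refine ⟨y.natAbs, Int.natAbs_pos.mpr hy, ?_⟩
  rw [zsmul_eq_mul] at hyx
  rcases Int.natAbs_eq y with h | h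
  · rwa [h, Int.cast_natCast] at hyx
  · rw [h, Int.cast_neg, Int.cast_natCast, neg_mul] at hyx
    simpa using hyx.neg

theorem hasArithmeticGrowth_const (x : Qbar) : HasArithmeticGrowth fun _ => x := by
  obtain ⟨M, hM, hconj⟩ := exists_norm_conjugates_le x
  obtain ⟨d, hd, hint⟩ := exists_natCast_mul_isIntegral x
  exact ⟨⟨M, by positivity, fun σ n => (hconj σ).trans (le_self_pow₀ hM n.succ_ne_zero)⟩,
    d, hd, fun n => ⟨d, hd, Nat.le_self_pow n.succ_ne_zero d, fun _ _ => hint⟩⟩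

theorem hasArithmeticGrowth_pow (x : Qbar) : HasArithmeticGrowth fun n => x ^ n := by
  obtain ⟨M, hM, hconj⟩ := exists_norm_conjugates_le x
  obtain ⟨d, hd, hint⟩ := exists_natCast_mul_isIntegral x
  refine ⟨⟨M, by positivity, fun σ n => ?_⟩, d, hd, fun n => ⟨d ^ n, by positivity,
    Nat.pow_le_pow_right hd n.le_succ, fun k hk => ?_⟩⟩
  · rw [map_pow, SubmonoidClass.coe_pow, norm_pow]
    exact (pow_le_pow_left₀ (norm_nonneg _) (hconj σ) n).trans (pow_le_pow_right₀ hM n.le_succ)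
  · obtain ⟨j, rfl⟩ := Nat.exists_eq_add_of_le hk
    have hsplit : ((d ^ (k + j) : ℕ) : Qbar) * x ^ k = d ^ j * (d * x) ^ k := by
      push_cast
      ring
    exact hsplit ▸ ((isIntegral_natCast d).pow j).mul (hint.pow k)

theorem HasArithmeticGrowth.pow (ha : HasArithmeticGrowth a) (s : ℕ) :
    HasArithmeticGrowth fun n => a n ^ s := by
  induction s with
  | zero => simpa using hasArithmeticGrowth_const 1
  | succ s ih => simpa only [pow_succ] using ih.mul ha

theorem hasArithmeticGrowth_ratCast {q : ℕ → ℚ} {C : ℝ} {D : ℕ} (hC : 0 < C) (hD : 0 < D)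
    (hq : ∀ n, |(q n : ℝ)| ≤ C ^ (n + 1))
    (hden : ∀ n, ∃ d : ℕ, 0 < d ∧ d ≤ D ^ (n + 1) ∧ ∀ k ≤ n, ∃ z : ℤ, (d : ℚ) * q k = z) :
    HasArithmeticGrowth fun n => (q n : Qbar) := by
  refine ⟨⟨C, hC, fun σ n => ?_⟩, D, hD, fun n => ?_⟩
  · have hfix : ((σ (q n : Qbar) : Qbar) : ℂ) = ((q n : ℝ) : ℂ) := by
      rw [map_ratCast]
      norm_cast
    rw [hfix, Complex.norm_real, Real.norm_eq_abs]
    exact hq n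
  · obtain ⟨d, hd, hdD, hz⟩ := hden n
    refine ⟨d, hd, hdD, fun k hk => ?_⟩
    obtain ⟨z, hz⟩ := hz k hk
    have hcast : (d : Qbar) * (q k : Qbar) = (z : Qbar) := by
      exact_mod_cast congrArg (Rat.cast (K := Qbar)) hz
    rw [hcast]
    exact isIntegral_intCast z

end ArithmeticGrowth

section Denominators

theorem exists_lcmUpto_le_pow : ∃ D : ℕ, 0 < D ∧ ∀ n, Nat.lcmUpto n ≤ D ^ n := by
  refine ⟨⌈Real.exp (Real.log 4 + 4)⌉₊, Nat.ceil_pos.mpr (Real.exp_pos _), fun n => ?_⟩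
  have hpsi := Chebyshev.psi_le_const_mul_self (Nat.cast_nonneg (α := ℝ) n)
  rw [Chebyshev.psi_eq_log_lcmUpto, Real.log_le_iff_le_exp
    (by exact_mod_cast Nat.lcmUpto_pos n), mul_comm, Real.exp_nat_mul] at hpsi
  have hceil : (Nat.lcmUpto n : ℝ) ≤ (⌈Real.exp (Real.log 4 + 4)⌉₊ : ℝ) ^ n :=
    hpsi.trans (by gcongr; exact Nat.le_ceil _)
  exact_mod_cast hceil

theorem dvd_lcmUpto {k n : ℕ} (hk : 1 ≤ k) (hkn : k ≤ n) : k ∣ Nat.lcmUpto n :=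
  Finset.dvd_lcm (f := id) (Finset.mem_Icc.mpr ⟨hk, hkn⟩)

theorem exists_lcmUpto_mul_one_div_eq_intCast {z : ℤ} {n : ℕ} (hz : z.natAbs ≤ n) :
    ∃ m : ℤ, (Nat.lcmUpto n : ℚ) * (1 / z) = m := by
  rcases eq_or_ne z 0 with rfl | hz0
  · exact ⟨0, by simp⟩
  obtain ⟨m, hm⟩ := Int.natAbs_dvd.mp (Int.natCast_dvd_natCast.mpr
    (dvd_lcmUpto (Nat.one_le_iff_ne_zero.mpr (Int.natAbs_ne_zero.mpr hz0)) hz))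
  refine ⟨m, ?_⟩
  have hcast : (Nat.lcmUpto n : ℚ) = z * m := by exact_mod_cast hm
  rw [hcast, mul_one_div, mul_div_cancel_left₀ _ (Int.cast_ne_zero.mpr hz0)]

theorem hasArithmeticGrowth_one_div_linear (m : ℕ) (p : ℤ) :
    HasArithmeticGrowth fun n => 1 / ((m : Qbar) * n + p) := by
  obtain ⟨D, hD, hlcm⟩ := exists_lcmUpto_le_pow
  have h := hasArithmeticGrowth_ratCast (q := fun n => 1 / ((m * n + p : ℤ) : ℚ)) (C := 1)
    (D := D ^ (m + p.natAbs)) one_pos (by positivity) (fun n => ?_) fun n =>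
      ⟨Nat.lcmUpto (m * n + p.natAbs), Nat.lcmUpto_pos _, (hlcm _).trans ?_, fun k hk => ?_⟩
  · simpa using h
  · rw [one_pow, Rat.cast_div, Rat.cast_one, Rat.cast_intCast, one_div, abs_inv]
    rcases eq_or_ne (m * n + p : ℤ) 0 with h0 | h0
    · simp [h0]
    · exact inv_le_one_of_one_le₀ (by exact_mod_cast Int.one_le_abs h0)
  · rw [← pow_mul]
    exact Nat.pow_le_pow_right hD (by nlinarith [Nat.zero_le (p.natAbs * n)])
  · have : m * k ≤ m * n := by gcongr
    exact exists_lcmUpto_mul_one_div_eq_intCast (by zify; grind)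

theorem dvd_prod_sub_mul_of_isCoprime {d q p : ℤ} {n : ℕ} (hd : d ∣ n.factorial)
    (hq : IsCoprime q d) : d ∣ ∏ i ∈ Finset.range n, (p - i * q) := by
  obtain ⟨x, y, hxy⟩ := hq
  have hx : IsCoprime d (x ^ n) := IsCoprime.pow_right ⟨y, q, by linear_combination hxy⟩
  refine hx.dvd_of_dvd_mul_left ?_
  -- As `x` inverts `q` modulo `d`, this is `n! * choose (p * x) n` modulo `d`.
  have hmod : x ^ n * ∏ i ∈ Finset.range n, (p - i * q) ≡
      ∏ i ∈ Finset.range n, (p * x - i) [ZMOD d] := by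
    nth_rw 1 [← Finset.card_range n]
    rw [Finset.pow_card_mul_prod]
    refine Int.ModEq.prod fun i _ => Int.modEq_iff_dvd.mpr ⟨-i * y, ?_⟩
    linear_combination (i : ℤ) * hxy
  rw [← factorial_mul_choose_eq_prod] at hmod
  exact hmod.dvd_iff.mpr (hd.mul_right _)

theorem factorial_dvd_pow_mul_prod_sub_mul (p : ℤ) (q n : ℕ) :
    (n.factorial : ℤ) ∣ (q : ℤ) ^ n * ∏ i ∈ Finset.range n, (p - i * q) := by
  rw [← Int.natAbs_dvd_natAbs, Int.natAbs_natCast, Nat.dvd_iff_prime_pow_dvd_dvd]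
  intro l v hl hv
  rw [← Int.natCast_dvd]
  by_cases hlq : l ∣ q
  · have : Fact l.Prime := ⟨hl⟩
    have hvn : v ≤ n := ((padicValNat_dvd_iff_le n.factorial_ne_zero).mp hv).trans
      (padicValNat_factorial_le l n)
    refine Dvd.dvd.mul_right ?_ _
    exact_mod_cast (pow_dvd_pow l hvn).trans (pow_dvd_pow_of_dvd hlq n)
  · refine Dvd.dvd.mul_left (dvd_prod_sub_mul_of_isCoprime (by exact_mod_cast hv) ?_) _
    exact Nat.isCoprime_iff_coprime.mpr
      (((Nat.Prime.coprime_iff_not_dvd hl).mpr hlq).symm.pow_right v)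

theorem exists_den_pow_mul_choose_eq_intCast (α : ℚ) (n : ℕ) :
    ∃ z : ℤ, (α.den : ℚ) ^ (2 * n) * Ring.choose α n = z := by
  obtain ⟨z, hz⟩ := factorial_dvd_pow_mul_prod_sub_mul α.num α.den n
  refine ⟨z, mul_left_cancel₀ (Nat.cast_ne_zero.mpr n.factorial_ne_zero) ?_⟩
  have hprod : (α.den : ℚ) ^ n * ∏ i ∈ Finset.range n, (α - i) =
      ∏ i ∈ Finset.range n, ((α.num : ℚ) - i * α.den) := by
    nth_rw 1 [← Finset.card_range n]
    rw [Finset.pow_card_mul_prod]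
    refine Finset.prod_congr rfl fun i _ => ?_
    linear_combination Rat.mul_den_eq_num α
  have hcast := congrArg (Int.cast (R := ℚ)) hz
  push_cast at hcast
  rw [← hcast, ← hprod, ← factorial_mul_choose_eq_prod]
  ring

theorem abs_choose_le (α : ℚ) (n : ℕ) : |Ring.choose α n| ≤ (1 + |α|) ^ n := by
  have hfactor (i : ℕ) : |α - i| ≤ (i + 1) * (1 + |α|) := by
    have := abs_sub α i
    rw [Nat.abs_cast] at this
    nlinarith [abs_nonneg α, (Nat.cast_nonneg i : (0 : ℚ) ≤ i)]
  have hn : (0 : ℚ) < n.factorial := by exact_mod_cast n.factorial_pos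
  refine le_of_mul_le_mul_left ?_ hn
  calc (n.factorial : ℚ) * |Ring.choose α n| = ∏ i ∈ Finset.range n, |α - i| := by
        rw [← Finset.abs_prod, ← factorial_mul_choose_eq_prod, abs_mul, Nat.abs_cast]
    _ ≤ ∏ i ∈ Finset.range n, (((i : ℚ) + 1) * (1 + |α|)) :=
        Finset.prod_le_prod (fun _ _ => abs_nonneg _) fun i _ => hfactor i
    _ = n.factorial * (1 + |α|) ^ n := by
        rw [Finset.prod_mul_distrib, Finset.prod_const, Finset.card_range,
          ← Finset.prod_range_add_one_eq_factorial]
        push_cast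
        rfl

theorem hasArithmeticGrowth_choose (α : ℚ) :
    HasArithmeticGrowth fun n => ((Ring.choose α n : ℚ) : Qbar) := by
  refine hasArithmeticGrowth_ratCast (C := 1 + |α|) (D := α.den ^ 2) (by positivity)
    (pow_pos α.den_pos _) (fun n => ?_) fun n => ⟨α.den ^ (2 * n), pow_pos α.den_pos _, ?_,
      fun k hk => ?_⟩
  · have : |Ring.choose α n| ≤ (1 + |α|) ^ (n + 1) :=
      (abs_choose_le α n).trans (pow_le_pow_right₀ (by simp) n.le_succ)
    exact_mod_cast this
  · rw [← pow_mul]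
    exact Nat.pow_le_pow_right α.den_pos (by omega)
  · obtain ⟨j, rfl⟩ := Nat.exists_eq_add_of_le hk
    obtain ⟨z, hz⟩ := exists_den_pow_mul_choose_eq_intCast α k
    refine ⟨α.den ^ (2 * j) * z, ?_⟩
    push_cast
    rw [← hz]
    ring

end Denominators

section ArithmeticSeries

open Finset.HasAntidiagonal

variable {F G : Qbar⟦X⟧}

theorem HasArithmeticGrowth.coeff_mul
    (hF : HasArithmeticGrowth fun n => PowerSeries.coeff n F)
    (hG : HasArithmeticGrowth fun n => PowerSeries.coeff n G) :
    HasArithmeticGrowth fun n => PowerSeries.coeff n (F * G) := by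
  simpa only [PowerSeries.coeff_mul] using hF.antidiagonal_sum_mul hG

theorem hasArithmeticGrowth_coeff_log :
    HasArithmeticGrowth fun n => PowerSeries.coeff n (PowerSeries.log Qbar) := by
  convert (hasArithmeticGrowth_const (-1)).mul
    ((hasArithmeticGrowth_pow (-1)).mul (hasArithmeticGrowth_one_div_linear 1 0)) using 2 with n
  rcases eq_or_ne n 0 with rfl | hn
  · simp
  · simp [PowerSeries.coeff_log, hn, pow_succ, div_eq_mul_inv]

theorem hasArithmeticGrowth_coeff_binomialLogSeries (α : ℚ) (k : ℕ) :
    HasArithmeticGrowth fun n => PowerSeries.coeff n (binomialLogSeries α k) := by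
  induction k with
  | zero =>
    simpa [binomialLogSeries, Algebra.smul_def] using hasArithmeticGrowth_choose α
  | succ k ih =>
    simpa only [binomialLogSeries, pow_succ, mul_assoc] using
      ih.coeff_mul hasArithmeticGrowth_coeff_log

theorem borelTransform_seriesAntie (a : ℚ) (k : ℕ) :
    borelTransform (seriesAntie a k) = binomialLogSeries (a - 1) k := by
  ext n : 1
  rw [borelTransform, PowerSeries.coeff_mk, seriesAntie, PowerSeries.coeff_mk,
    mul_div_cancel_left₀ _ (by exact_mod_cast n.factorial_ne_zero), binomialLogSeries]

theorem IsEFunction.of_forall_factorial_mul_coeff_eq {a : ℕ → Qbar} (hF : IsHolonomic F)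
    (ha : HasArithmeticGrowth a)
    (h : ∀ n, (n.factorial : Qbar) * PowerSeries.coeff n F = a n) : IsEFunction F := by
  obtain rfl : (fun n => (n.factorial : Qbar) * PowerSeries.coeff n F) = a := funext h
  exact ⟨hF, ha⟩

theorem isGFunction_binomialLogSeries (α : ℚ) (k : ℕ) : IsGFunction (binomialLogSeries α k) :=
  .of_forall_factorial_mul_coeff_eq (isHolonomic_borelTransform_binomialLogSeries α k)
    (hasArithmeticGrowth_coeff_binomialLogSeries α k) (factorial_mul_coeff_borelTransform _)

theorem isAntieFunction_seriesAntie (a : ℚ) (k : ℕ) : IsAntieFunction (seriesAntie a k) := by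
  rw [IsAntieFunction, borelTransform_seriesAntie]
  exact isGFunction_binomialLogSeries _ _

theorem IsEFunction.add (hF : IsEFunction F) (hG : IsEFunction G) : IsEFunction (F + G) :=
  .of_forall_factorial_mul_coeff_eq (hF.1.add hG.1) (HasArithmeticGrowth.add hF.2 hG.2)
    fun n => by rw [map_add, mul_add]

theorem factorial_mul_coeff_mul (F G : Qbar⟦X⟧) (n : ℕ) :
    (n.factorial : Qbar) * PowerSeries.coeff n (F * G) =
      ∑ p ∈ antidiagonal n, ((p.1 + p.2).choose p.1 : Qbar) *
        ((p.1.factorial * PowerSeries.coeff p.1 F) *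
          (p.2.factorial * PowerSeries.coeff p.2 G)) := by
  rw [PowerSeries.coeff_mul, Finset.mul_sum]
  refine Finset.sum_congr rfl fun p hp => ?_
  rw [← mem_antidiagonal.mp hp, ← Nat.add_choose_mul_factorial_mul_factorial,
    Nat.choose_symm_add]
  push_cast
  ring

theorem IsEFunction.mul (hF : IsEFunction F) (hG : IsEFunction G) : IsEFunction (F * G) :=
  .of_forall_factorial_mul_coeff_eq (hF.1.mul hG.1)
    (HasArithmeticGrowth.antidiagonal_sum_choose_mul hF.2 hG.2) (factorial_mul_coeff_mul F G)

theorem IsEFunction.rescale (hF : IsEFunction F) (c : Qbar) :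
    IsEFunction (PowerSeries.rescale c F) :=
  .of_forall_factorial_mul_coeff_eq (hF.1.rescale c) ((hasArithmeticGrowth_pow c).mul hF.2)
    fun n => by rw [PowerSeries.coeff_rescale, mul_left_comm]

theorem isEFunction_C (c : Qbar) : IsEFunction (PowerSeries.C c) := by
  refine .of_forall_factorial_mul_coeff_eq (isHolonomic_C c)
    ((hasArithmeticGrowth_const c).mul (hasArithmeticGrowth_pow 0)) fun n => ?_
  rcases eq_or_ne n 0 with rfl | hn <;> simp [PowerSeries.coeff_C, *]

theorem isEFunction_exp : IsEFunction (PowerSeries.exp Qbar) := by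
  refine .of_forall_factorial_mul_coeff_eq
    (isHolonomic_of_derivative_eq_self (PowerSeries.derivative_exp Qbar))
    (hasArithmeticGrowth_const 1) fun n => ?_
  rw [PowerSeries.coeff_exp, map_div₀, map_one, map_natCast]
  exact mul_one_div_cancel (by exact_mod_cast n.factorial_ne_zero)

theorem hasArithmeticGrowth_one_div_natCast_add (a : ℚ) :
    HasArithmeticGrowth fun n => 1 / ((n : Qbar) + a) := by
  convert (hasArithmeticGrowth_const a.den).mul
    (hasArithmeticGrowth_one_div_linear a.den a.num) using 2 with n
  have hden : (a.den : Qbar) ≠ 0 := by exact_mod_cast a.den_ne_zero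
  have hnum : (a.num : Qbar) = a.den * a := by
    exact_mod_cast congrArg (Rat.cast (K := Qbar)) (Rat.den_mul_eq_num a).symm
  rw [hnum, ← mul_add, mul_one_div, div_mul_cancel_left₀ hden, one_div]

theorem isEFunction_seriesE {a : ℚ} (ha : ∀ n : ℕ, (n : ℚ) + a ≠ 0) (s : ℕ) :
    IsEFunction (seriesE a s) := by
  refine .of_forall_factorial_mul_coeff_eq (isHolonomic_seriesE ha s)
    ((hasArithmeticGrowth_one_div_natCast_add a).pow s) fun n => ?_
  have hn : (n.factorial : Qbar) ≠ 0 := by exact_mod_cast n.factorial_ne_zero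
  rw [seriesE, PowerSeries.coeff_mk, one_div_pow, ← div_div, ← mul_div_assoc,
    mul_one_div_cancel hn]

theorem IsAntieFunction.add_C {f : Qbar⟦X⟧} (hf : IsAntieFunction f) (c : Qbar) :
    IsAntieFunction (f + PowerSeries.C c) := by
  change IsEFunction (borelTransform (borelTransform (f + PowerSeries.C c)))
  rw [borelTransform_add, borelTransform_add, borelTransform_C, borelTransform_C]
  exact IsEFunction.add hf (isEFunction_C c)

end ArithmeticSeries

section Values

open Finset.HasAntidiagonal

variable {F G : Qbar⟦X⟧} {z u v : ℂ}

theorem HasValueAt.add (hF : HasValueAt F z u) (hG : HasValueAt G z v) :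
    HasValueAt (F + G) z (u + v) := by
  refine (HasSum.add hF hG).congr_fun fun n => ?_
  rw [map_add, AddMemClass.coe_add, add_mul]

theorem HasValueAt.mul (hF : HasValueAt F z u) (hG : HasValueAt G z v) :
    HasValueAt (F * G) z (u * v) := by
  have hF' := hF.summable.norm
  have hG' := hG.summable.norm
  have h := (summable_norm_sum_mul_antidiagonal_of_summable_norm hF' hG').of_norm.hasSum
  rw [← tsum_mul_tsum_eq_tsum_sum_antidiagonal_of_summable_norm hF' hG', hF.tsum_eq,
    hG.tsum_eq] at h
  refine h.congr_fun fun n => ?_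
  rw [PowerSeries.coeff_mul, AddSubmonoidClass.coe_finsetSum, Finset.sum_mul]
  refine Finset.sum_congr rfl fun p hp => ?_
  rw [← mem_antidiagonal.mp hp, pow_add, MulMemClass.coe_mul]
  ring

theorem hasValueAt_C (c : Qbar) (z : ℂ) : HasValueAt (PowerSeries.C c) z c := by
  have h := hasSum_single (f := fun n : ℕ =>
    ((PowerSeries.coeff n (PowerSeries.C c) : Qbar) : ℂ) * z ^ n) 0
    fun n hn => by simp [PowerSeries.coeff_C, hn]
  simpa [HasValueAt] using h

theorem HasValueAt.pow (hF : HasValueAt F z u) (n : ℕ) : HasValueAt (F ^ n) z (u ^ n) := by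
  induction n with
  | zero => simpa using hasValueAt_C 1 z
  | succ n ih => simpa only [pow_succ] using ih.mul hF

theorem HasValueAt.rescale {ξ : Qbar} (hF : HasValueAt F (ξ * z) u) :
    HasValueAt (PowerSeries.rescale ξ F) z u := by
  refine hF.congr_fun fun n => ?_
  rw [PowerSeries.coeff_rescale]
  push_cast
  ring

theorem hasValueAt_exp (z : ℂ) : HasValueAt (PowerSeries.exp Qbar) z (Complex.exp z) := by
  have h := NormedSpace.expSeries_div_hasSum_exp z
  rw [← Complex.exp_eq_exp_ℂ] at h
  refine h.congr_fun fun n => ?_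
  simp [PowerSeries.coeff_exp, div_eq_inv_mul]

theorem hasValueAt_binomialSeries (α : ℚ) {x : ℂ} (hx : ‖x‖ < 1) :
    HasValueAt (PowerSeries.binomialSeries Qbar α) x ((1 + x) ^ (α : ℂ)) := by
  have h := (Complex.one_add_cpow_hasFPowerSeriesOnBall_zero (a := (α : ℂ))).hasSum (y := x)
    (by rwa [Metric.mem_eball, edist_zero_right, ← ofReal_norm, ENNReal.ofReal_lt_one])
  rw [zero_add] at h
  refine h.congr_fun fun n => ?_
  have hchoose := Ring.map_choose (Rat.castHom ℂ) α n
  rw [Rat.coe_castHom] at hchoose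
  rw [binomialSeries_apply, PowerSeries.binomialSeries_coeff, Rat.smul_one_eq_cast, ← hchoose]
  simp

theorem hasValueAt_log {x : ℂ} (hx : ‖x‖ < 1) :
    HasValueAt (PowerSeries.log Qbar) x (Complex.log (1 + x)) := by
  refine (Complex.hasSum_taylorSeries_log hx).congr_fun fun n => ?_
  rcases eq_or_ne n 0 with rfl | hn
  · simp
  · simp [PowerSeries.coeff_log, hn, mul_div_right_comm]

theorem mem_valuesE_iff {w : ℂ} :
    w ∈ valuesE ↔ ∃ F : Qbar⟦X⟧, IsEFunction F ∧ HasValueAt F 1 w := by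
  constructor
  · rintro ⟨F, hF, ξ, hw⟩
    exact ⟨_, hF.rescale ξ, HasValueAt.rescale (by rwa [mul_one])⟩
  · rintro ⟨F, hF, hw⟩
    exact ⟨F, hF, 1, by simpa using hw⟩

theorem mul_mem_valuesE (hu : u ∈ valuesE) (hv : v ∈ valuesE) : u * v ∈ valuesE := by
  obtain ⟨F, hF, hu⟩ := mem_valuesE_iff.mp hu
  obtain ⟨G, hG, hv⟩ := mem_valuesE_iff.mp hv
  exact mem_valuesE_iff.mpr ⟨F * G, hF.mul hG, hu.mul hv⟩

theorem coe_mem_valuesE (c : Qbar) : (c : ℂ) ∈ valuesE :=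
  mem_valuesE_iff.mpr ⟨_, isEFunction_C c, hasValueAt_C c 1⟩

theorem exp_mem_valuesE (ξ : Qbar) : Complex.exp ξ ∈ valuesE :=
  ⟨_, isEFunction_exp, ξ, hasValueAt_exp ξ⟩

end Values

section OneSummability

variable {f g : Qbar⟦X⟧} {θ : ℝ} {B B' : ℂ → ℂ} {z u v : ℂ}

theorem sectorAround_subset_sectorAround {ε ε' : ℝ} (h : ε ≤ ε') :
    sectorAround θ ε ⊆ sectorAround θ ε' :=
  fun _ hx => ⟨hx.1, hx.2.trans_le h⟩

theorem ofReal_mul_exp_mem_sectorAround {t ε : ℝ} (ht : 0 < t) (hε : 0 < ε) :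
    (t : ℂ) * Complex.exp (-(θ * Complex.I)) ∈ sectorAround θ ε := by
  refine ⟨mul_ne_zero (Complex.ofReal_ne_zero.mpr ht.ne') (Complex.exp_ne_zero _), ?_⟩
  rwa [mul_assoc, ← Complex.exp_add, neg_add_cancel, Complex.exp_zero, mul_one,
    Complex.arg_ofReal_of_nonneg ht.le, abs_zero]

theorem IsBorelContinuation.add (hB : IsBorelContinuation f θ B)
    (hB' : IsBorelContinuation g θ B') : IsBorelContinuation (f + g) θ (B + B') := by
  obtain ⟨ε, hε, hdiff, hval, hgrowth⟩ := hB
  obtain ⟨ε', hε', hdiff', hval', hgrowth'⟩ := hB'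
  have hball := Metric.ball_subset_ball (x := (0 : ℂ)) (min_le_left ε ε')
  have hball' := Metric.ball_subset_ball (x := (0 : ℂ)) (min_le_right ε ε')
  have hsector := sectorAround_subset_sectorAround (θ := θ) (min_le_left ε ε')
  have hsector' := sectorAround_subset_sectorAround (θ := θ) (min_le_right ε ε')
  refine ⟨min ε ε', lt_min hε hε', (hdiff.mono (Set.union_subset_union hball hsector)).add
    (hdiff'.mono (Set.union_subset_union hball' hsector')), fun x hx => ?_, fun K hK => ?_⟩
  · rw [borelTransform_add]
    exact (hval x (hball hx)).add (hval' x (hball' hx))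
  · obtain ⟨C, hC⟩ := hgrowth K hK
    obtain ⟨C', hC'⟩ := hgrowth' K hK
    refine ⟨C + C', fun x hx => ?_⟩
    rw [add_mul]
    exact norm_add_le_of_le (hC x (hsector hx)) (hC' x (hsector' hx))

theorem isBorelContinuation_C (c : Qbar) (θ : ℝ) :
    IsBorelContinuation (PowerSeries.C c) θ fun _ => c := by
  refine ⟨1, one_pos, differentiableOn_const _, fun x _ => ?_, fun K hK => ⟨‖(c : ℂ)‖, fun x _ =>
    le_mul_of_one_le_right (norm_nonneg _) (Real.one_le_exp (by positivity))⟩⟩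
  rw [borelTransform_C]
  exact hasValueAt_C c x

theorem isAntiStokes_add_C_iff (c : Qbar) :
    IsAntiStokes (f + PowerSeries.C c) θ ↔ IsAntiStokes f θ := by
  refine not_congr ⟨fun ⟨B, hB⟩ => ?_, fun ⟨B, hB⟩ => ⟨_, hB.add (isBorelContinuation_C c θ)⟩⟩
  have h := hB.add (isBorelContinuation_C (-c) θ)
  rw [map_neg, add_neg_cancel_right] at h
  exact ⟨_, h⟩

theorem IsBorelContinuation.integrableOn_laplace (hB : IsBorelContinuation f θ B)
    (hz : 0 < (z * Complex.exp (-(θ * Complex.I))).re) :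
    MeasureTheory.IntegrableOn (fun t : ℝ => B (t * Complex.exp (-(θ * Complex.I))) *
      Complex.exp (-(t * Complex.exp (-(θ * Complex.I)) * z)) *
        Complex.exp (-(θ * Complex.I))) (Set.Ioi 0) := by
  obtain ⟨ε, hε, hdiff, -, hgrowth⟩ := hB
  have hray {t : ℝ} (ht : 0 < t) :=
    ofReal_mul_exp_mem_sectorAround (θ := θ) ht hε
  set e := Complex.exp (-(θ * Complex.I)) with he
  have hnorm : ‖e‖ = 1 := by
    rw [he, ← neg_mul, ← Complex.ofReal_neg, Complex.norm_exp_ofReal_mul_I]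
  -- Bound `B` by `exp (K |x|)` with `K` half of the decay rate of the Laplace kernel.
  obtain ⟨C, hC⟩ := hgrowth ((z * e).re / 2) (half_pos hz)
  have hcont : ContinuousOn (fun t : ℝ => B (t * e) * Complex.exp (-(t * e * z)) * e)
      (Set.Ioi 0) := by
    have hcomp : ContinuousOn (fun t : ℝ => B (t * e)) (Set.Ioi 0) :=
      hdiff.continuousOn.comp (f := fun t : ℝ => (t : ℂ) * e) (by fun_prop)
        fun t ht => Or.inr (hray ht)
    exact (hcomp.mul (by fun_prop)).mul continuousOn_const
  refine ((exp_neg_integrableOn_Ioi 0 (half_pos hz)).const_mul C).mono'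
    (hcont.aestronglyMeasurable measurableSet_Ioi) ?_
  refine (MeasureTheory.ae_restrict_mem measurableSet_Ioi).mono fun t (ht : 0 < t) => ?_
  have hBt := hC _ (hray ht)
  rw [norm_mul, hnorm, mul_one, Complex.norm_of_nonneg ht.le] at hBt
  have hre : (-(t * e * z)).re = -((z * e).re * t) := by
    rw [Complex.neg_re, ← Complex.re_mul_ofReal]
    ring_nf
  rw [norm_mul, norm_mul, hnorm, mul_one, Complex.norm_exp, hre]
  calc ‖B (t * e)‖ * Real.exp (-((z * e).re * t))
      ≤ C * Real.exp ((z * e).re / 2 * t) * Real.exp (-((z * e).re * t)) := by gcongr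
    _ = C * Real.exp (-((z * e).re / 2) * t) := by
        rw [mul_assoc, ← Real.exp_add]
        ring_nf

theorem HasOneSumAt.add (hf : HasOneSumAt f θ z u) (hg : HasOneSumAt g θ z v) :
    HasOneSumAt (f + g) θ z (u + v) := by
  obtain ⟨hz, B, hB, rfl⟩ := hf
  obtain ⟨-, B', hB', rfl⟩ := hg
  refine ⟨hz, B + B', hB.add hB', ?_⟩
  rw [← mul_add, ← MeasureTheory.integral_add (hB.integrableOn_laplace hz)
    (hB'.integrableOn_laplace hz)]
  simp only [Pi.add_apply, add_mul]

theorem hasOneSumAt_C (c : Qbar) (hz : 0 < (z * Complex.exp (-(θ * Complex.I))).re) :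
    HasOneSumAt (PowerSeries.C c) θ z c := by
  refine ⟨hz, _, isBorelContinuation_C c θ, ?_⟩
  set e := Complex.exp (-(θ * Complex.I))
  have hze : z * e ≠ 0 := by
    rintro h
    simp [h] at hz
  have hintegrand (t : ℝ) : (c : ℂ) * Complex.exp (-(t * e * z)) * e =
      c * e * Complex.exp (-(z * e) * t) := by
    rw [mul_right_comm]
    ring_nf
  simp only [hintegrand]
  rw [MeasureTheory.integral_const_mul, integral_exp_mul_complex_Ioi (by simpa using hz),
    Complex.ofReal_zero, mul_zero, Complex.exp_zero, neg_div_neg_eq, mul_one_div,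
    ← mul_div_assoc, eq_div_iff hze]
  ring

end OneSummability

section PowLog

/-- The function `w ^ α * log w ^ k`, with principal branches. At `w = 1 + x` it is the sum of
`binomialLogSeries α k`, and hence the Borel continuation of `seriesAntie (α + 1) k`. -/
noncomputable def powLog (α : ℂ) (k : ℕ) (w : ℂ) : ℂ :=
  w ^ α * Complex.log w ^ k

theorem hasValueAt_binomialLogSeries (α : ℚ) (k : ℕ) {x : ℂ} (hx : ‖x‖ < 1) :
    HasValueAt (binomialLogSeries α k) x (powLog α k (1 + x)) :=
  (hasValueAt_binomialSeries α hx).mul ((hasValueAt_log hx).pow k)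

theorem differentiableAt_powLog (α : ℂ) (k : ℕ) {w : ℂ} (hw : w ∈ Complex.slitPlane) :
    DifferentiableAt ℂ (powLog α k) w :=
  (differentiableAt_id.cpow (differentiableAt_const α) hw).mul
    ((Complex.differentiableAt_log hw).pow k)

theorem norm_log_le_of_one_le_norm {w : ℂ} (hw : 1 ≤ ‖w‖) :
    ‖Complex.log w‖ ≤ (1 + Real.pi) * ‖w‖ := by
  refine (Complex.norm_le_abs_re_add_abs_im _).trans ?_
  rw [Complex.log_re, Complex.log_im, abs_of_nonneg (Real.log_nonneg hw)]
  nlinarith [Real.log_le_self (norm_nonneg w), Complex.abs_arg_le_pi w, Real.pi_pos]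

theorem norm_powLog_le (α : ℝ) (k : ℕ) {w : ℂ} (hw : 1 ≤ ‖w‖) :
    ‖powLog α k w‖ ≤ (1 + Real.pi) ^ k * ‖w‖ ^ (⌈α⌉₊ + k) := by
  have hcpow : ‖w ^ (α : ℂ)‖ ≤ ‖w‖ ^ ⌈α⌉₊ := by
    rw [Complex.norm_cpow_real, ← Real.rpow_natCast]
    exact Real.rpow_le_rpow_of_exponent_le hw (Nat.le_ceil α)
  calc ‖powLog α k w‖ = ‖w ^ (α : ℂ)‖ * ‖Complex.log w‖ ^ k := by
        rw [powLog, norm_mul, norm_pow]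
    _ ≤ ‖w‖ ^ ⌈α⌉₊ * ((1 + Real.pi) * ‖w‖) ^ k := by
        gcongr
        exact norm_log_le_of_one_le_norm hw
    _ = (1 + Real.pi) ^ k * ‖w‖ ^ (⌈α⌉₊ + k) := by
        rw [mul_pow, pow_add]
        ring

theorem one_add_pow_le_mul_exp {K t : ℝ} (hK : 0 < K) (ht : 0 ≤ t) (m : ℕ) :
    (1 + t) ^ m ≤ (m.factorial / K ^ m * Real.exp K) * Real.exp (K * t) := by
  have h := Real.pow_div_factorial_le_exp (K * (1 + t)) (by positivity) m
  rw [mul_add, mul_one, Real.exp_add, div_le_iff₀ (by positivity), ← mul_one_add, mul_pow] at h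
  rw [div_mul_eq_mul_div, div_mul_eq_mul_div, le_div_iff₀ (by positivity)]
  linarith

theorem re_pos_of_mem_sectorAround {ε : ℝ} (hε : ε ≤ Real.pi / 2) {x : ℂ}
    (hx : x ∈ sectorAround 0 ε) : 0 < x.re := by
  obtain ⟨h0, harg⟩ := hx
  simp only [Complex.ofReal_zero, zero_mul, Complex.exp_zero, mul_one] at harg
  exact (Complex.abs_arg_lt_pi_div_two_iff.mp (harg.trans_le hε)).resolve_right h0

theorem exists_norm_powLog_one_add_le_exp (α : ℝ) (k : ℕ) {K : ℝ} (hK : 0 < K) :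
    ∃ C : ℝ, ∀ x : ℂ, 0 ≤ x.re → ‖powLog α k (1 + x)‖ ≤ C * Real.exp (K * ‖x‖) := by
  set m := ⌈α⌉₊ + k
  refine ⟨(1 + Real.pi) ^ k * (m.factorial / K ^ m * Real.exp K), fun x hx => ?_⟩
  have hnorm : 1 ≤ ‖1 + x‖ := by
    have := Complex.re_le_norm (1 + x)
    rw [Complex.add_re, Complex.one_re] at this
    linarith
  have := Real.pi_pos
  calc ‖powLog α k (1 + x)‖ ≤ (1 + Real.pi) ^ k * ‖1 + x‖ ^ m := norm_powLog_le α k hnorm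
    _ ≤ (1 + Real.pi) ^ k * (1 + ‖x‖) ^ m := by
        gcongr
        simpa using norm_add_le 1 x
    _ ≤ (1 + Real.pi) ^ k * (m.factorial / K ^ m * Real.exp K * Real.exp (K * ‖x‖)) := by
        gcongr
        exact one_add_pow_le_mul_exp hK (norm_nonneg x) m
    _ = (1 + Real.pi) ^ k * (m.factorial / K ^ m * Real.exp K) * Real.exp (K * ‖x‖) := by ring

theorem isBorelContinuation_seriesAntie (a : ℚ) (k : ℕ) :
    IsBorelContinuation (seriesAntie a k) 0 fun x => powLog (a - 1) k (1 + x) := by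
  have hre {x : ℂ} (hx : x ∈ sectorAround 0 1) : 0 < x.re :=
    re_pos_of_mem_sectorAround (by linarith [Real.pi_gt_three]) hx
  refine ⟨1, one_pos, fun x hx => ?_, fun x hx => ?_, fun K hK => ?_⟩
  · have hslit : 1 + x ∈ Complex.slitPlane := by
      rcases hx with hx | hx
      · exact Complex.mem_slitPlane_of_norm_lt_one (mem_ball_zero_iff.mp hx)
      · exact Or.inl (by simpa using add_pos one_pos (hre hx))
    exact ((differentiableAt_powLog _ k hslit).comp x (by fun_prop)).differentiableWithinAt
  · rw [borelTransform_seriesAntie]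
    simpa using hasValueAt_binomialLogSeries (a - 1) k (mem_ball_zero_iff.mp hx)
  · obtain ⟨C, hC⟩ := exists_norm_powLog_one_add_le_exp (a - 1) k hK
    exact ⟨C, fun x hx => by simpa using hC x (hre hx).le⟩

theorem hasOneSumAt_seriesAntie (a : ℚ) (k : ℕ) :
    HasOneSumAt (seriesAntie a k) 0 1
      (∫ t in Set.Ioi (0 : ℝ), powLog (a - 1) k (1 + t) * Complex.exp (-t)) :=
  ⟨by simp, _, isBorelContinuation_seriesAntie a k, by simp⟩

theorem integral_powLog_one_add_mul_exp_neg (α : ℝ) (k : ℕ) :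
    ∫ t in Set.Ioi (0 : ℝ), powLog α k (1 + t) * Complex.exp (-t) =
      ((∫ t in Set.Ioi (0 : ℝ), (1 + t) ^ α * Real.log (1 + t) ^ k * Real.exp (-t) : ℝ) : ℂ) := by
  rw [← integral_complex_ofReal]
  refine MeasureTheory.setIntegral_congr_fun measurableSet_Ioi fun t ht => ?_
  have ht' : (0 : ℝ) ≤ 1 + t := by linarith [Set.mem_Ioi.mp ht]
  simp only [powLog]
  push_cast [Complex.ofReal_cpow ht', Complex.ofReal_log ht']
  rfl

end PowLog

section MixedValues

theorem exists_plusPart_minusPart_eq (F f : Qbar⟦X⟧) (hf : PowerSeries.coeff 0 f = 0) :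
    ∃ Ψ : ℤ → Qbar, plusPart Ψ = F ∧ minusPart Ψ = f := by
  refine ⟨fun n => if 0 ≤ n then PowerSeries.coeff n.toNat F else
    PowerSeries.coeff (-n).toNat f, ?_, ?_⟩
  · ext n : 1
    simp [plusPart]
  · ext n : 1
    rcases eq_or_ne n 0 with rfl | hn
    · simp [minusPart, hf]
    · simp [minusPart, hn]

theorem valuesMixed_subset_add : valuesMixed ⊆ valuesE + valuesD := by
  rintro w ⟨Ψ, ⟨hF, hf⟩, ⟨hstokes, u, v, hu, hv, rfl⟩ | ⟨hstokes, hw⟩⟩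
  · exact Set.add_mem_add (mem_valuesE_iff.mpr ⟨_, hF, hu⟩) ⟨_, hf, Or.inl ⟨hstokes, hv⟩⟩
  · obtain ⟨_, u, _, hu, _⟩ := hw.exists
    refine ⟨u, mem_valuesE_iff.mpr ⟨_, hF, hu⟩, w - u, ⟨_, hf, Or.inr ⟨hstokes, ?_⟩⟩,
      add_sub_cancel u w⟩
    filter_upwards [hw] with θ ⟨u', v, hu', hv, hw⟩
    rwa [hw, hu'.unique hu, add_sub_cancel_left]

theorem add_subset_valuesMixed : valuesE + valuesD ⊆ valuesMixed := by
  rintro _ ⟨u, hu, v, ⟨f, hf, hv⟩, rfl⟩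
  obtain ⟨F, hF, hu⟩ := mem_valuesE_iff.mp hu
  -- A mixed function carries its constant term in its `plusPart`.
  set c := PowerSeries.coeff 0 f with hc
  obtain ⟨Ψ, hplus, hminus⟩ := exists_plusPart_minusPart_eq (F + PowerSeries.C c)
    (f + PowerSeries.C (-c)) (by simp [hc])
  have hval (θ : ℝ) (h : HasOneSumAt f θ 1 v) : MixedHasValueAt Ψ θ 1 (u + v) :=
    ⟨u + c, v + (-c : Qbar), hplus ▸ hu.add (hasValueAt_C c 1),
      hminus ▸ h.add (hasOneSumAt_C (-c) h.1), by push_cast; ring⟩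
  refine ⟨Ψ, ⟨hplus ▸ hF.add (isEFunction_C c), hminus ▸ hf.add_C (-c)⟩, ?_⟩
  rw [hminus, isAntiStokes_add_C_iff]
  exact hv.imp (And.imp_right (hval 0)) (And.imp_right fun h => h.mono hval)

theorem valuesMixed_eq_add : valuesMixed = valuesE + valuesD :=
  valuesMixed_subset_add.antisymm add_subset_valuesMixed

end MixedValues

section MellinStrip

open Asymptotics Filter MeasureTheory

variable {E : Type*} [NormedAddCommGroup E] [NormedSpace ℂ E] {g : ℝ → E} {c d : ℝ} {z : ℂ}

/-- `g` satisfies the usual growth conditions for its Mellin transform to converge on the strip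
`c < re z < d`. They are phrased so as to be stable under multiplication by `log`. -/
structure HasMellinStrip (g : ℝ → E) (c d : ℝ) : Prop where
  locallyIntegrableOn : LocallyIntegrableOn g (Set.Ioi 0)
  isBigO_atTop : ∀ b < d, g =O[atTop] (· ^ (-b))
  isBigO_zero : ∀ b, c < b → g =O[𝓝[>] 0] (· ^ (-b))

theorem HasMellinStrip.log_smul (hg : HasMellinStrip g c d) :
    HasMellinStrip (fun t => Real.log t • g t) c d where
  locallyIntegrableOn := hg.locallyIntegrableOn.continuousOn_smul isOpen_Ioi.isLocallyClosed
    (Real.continuousOn_log.mono fun _ ht => (Set.mem_Ioi.mp ht).ne')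
  isBigO_atTop b hb := by
    obtain ⟨b', hbb', hb'⟩ := exists_between hb
    exact isBigO_rpow_top_log_smul hbb' (hg.isBigO_atTop b' hb')
  isBigO_zero b hb := by
    obtain ⟨b', hb', hb'b⟩ := exists_between hb
    exact isBigO_rpow_zero_log_smul hb'b (hg.isBigO_zero b' hb')

theorem HasMellinStrip.log_pow_smul (hg : HasMellinStrip g c d) (k : ℕ) :
    HasMellinStrip (fun t => Real.log t ^ k • g t) c d := by
  induction k with
  | zero => simpa using hg
  | succ k ih => simpa only [pow_succ', mul_smul] using ih.log_smul

theorem HasMellinStrip.mellinConvergent (hg : HasMellinStrip g c d) (hc : c < z.re)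
    (hd : z.re < d) : MellinConvergent g z := by
  obtain ⟨a, hza, had⟩ := exists_between hd
  obtain ⟨b, hcb, hbz⟩ := exists_between hc
  exact mellinConvergent_of_isBigO_rpow hg.locallyIntegrableOn (hg.isBigO_atTop a had) hza
    (hg.isBigO_zero b hcb) hbz

theorem HasMellinStrip.hasDerivAt_mellin (hg : HasMellinStrip g c d) (hc : c < z.re)
    (hd : z.re < d) : HasDerivAt (mellin g) (mellin (fun t => Real.log t • g t) z) z := by
  obtain ⟨a, hza, had⟩ := exists_between hd
  obtain ⟨b, hcb, hbz⟩ := exists_between hc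
  exact (mellin_hasDerivAt_of_isBigO_rpow hg.locallyIntegrableOn (hg.isBigO_atTop a had) hza
    (hg.isBigO_zero b hcb) hbz).2

theorem HasMellinStrip.iteratedDeriv_mellin (hg : HasMellinStrip g c d) (k : ℕ) (hc : c < z.re)
    (hd : z.re < d) :
    iteratedDeriv k (mellin g) z = mellin (fun t => Real.log t ^ k • g t) z := by
  induction k generalizing z with
  | zero => simp
  | succ k ih =>
    have hstrip : ∀ᶠ w : ℂ in 𝓝 z, c < w.re ∧ w.re < d :=
      ((isOpen_lt continuous_const Complex.continuous_re).inter
        (isOpen_lt Complex.continuous_re continuous_const)).mem_nhds ⟨hc, hd⟩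
    rw [iteratedDeriv_succ, EventuallyEq.deriv_eq (hstrip.mono fun w hw => ih hw.1 hw.2),
      ((hg.log_pow_smul k).hasDerivAt_mellin hc hd).deriv]
    simp only [pow_succ', mul_smul]

theorem isBigO_one_rpow_neg_nhdsGT_zero {b : ℝ} (hb : 0 ≤ b) :
    (fun _ => 1 : ℝ → ℝ) =O[𝓝[>] 0] (· ^ (-b)) := by
  refine IsBigO.of_bound 1 ?_
  filter_upwards [Ioo_mem_nhdsGT (zero_lt_one (α := ℝ))] with t ht
  rw [one_mul, norm_one, Real.norm_of_nonneg (Real.rpow_nonneg ht.1.le _)]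
  exact Real.one_le_rpow_of_pos_of_le_one_of_nonpos ht.1 ht.2.le (neg_nonpos.mpr hb)

theorem hasMellinStrip_exp_neg (d : ℝ) :
    HasMellinStrip (fun t : ℝ => (Real.exp (-t) : ℂ)) 0 d where
  locallyIntegrableOn :=
    (Continuous.locallyIntegrable (by fun_prop)).locallyIntegrableOn _
  isBigO_atTop b _ := by
    refine isBigO_norm_left.mp ?_
    simpa [Complex.norm_exp] using (isLittleO_exp_neg_mul_rpow_atTop one_pos (-b)).isBigO
  isBigO_zero b hb := by
    refine IsBigO.trans (IsBigO.of_bound 1 ?_) (isBigO_one_rpow_neg_nhdsGT_zero hb.le)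
    filter_upwards [self_mem_nhdsWithin] with t ht
    simpa [Complex.norm_exp] using (Set.mem_Ioi.mp ht).le

theorem hasMellinStrip_indicator_Ioc (d : ℝ) :
    HasMellinStrip ((Set.Ioc 0 1).indicator fun _ => 1 : ℝ → ℂ) 0 d where
  locallyIntegrableOn := (((integrable_indicator_iff measurableSet_Ioc).mpr
    (by simp)).locallyIntegrable.locallyIntegrableOn _)
  isBigO_atTop b _ := by
    refine EventuallyEq.trans_isBigO ?_ (isBigO_zero _ _)
    filter_upwards [eventually_gt_atTop 1] with t ht
    exact Set.indicator_of_notMem (fun h => h.2.not_gt ht) _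
  isBigO_zero b hb := by
    refine IsBigO.trans (IsBigO.of_bound 1 (Eventually.of_forall fun t => ?_))
      (isBigO_one_rpow_neg_nhdsGT_zero hb.le)
    simpa using norm_indicator_le_norm_self (fun _ => (1 : ℂ)) t

end MellinStrip

section GammaDerivatives

open MeasureTheory

theorem cpow_smul_log_pow_smul (k : ℕ) (z y : ℂ) {t : ℝ} (ht : 0 ≤ t) :
    (t : ℂ) ^ z • Real.log t ^ k • y = powLog z k t * y := by
  rw [powLog, smul_eq_mul, Complex.real_smul, Complex.ofReal_pow, Complex.ofReal_log ht, mul_assoc]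

theorem mellin_log_pow_smul_eq_integral_powLog (g : ℝ → ℂ) (k : ℕ) (z : ℂ) :
    mellin (fun t => Real.log t ^ k • g t) z =
      ∫ t in Set.Ioi (0 : ℝ), powLog (z - 1) k t * g t :=
  setIntegral_congr_fun measurableSet_Ioi fun _ ht =>
    cpow_smul_log_pow_smul k (z - 1) _ (Set.mem_Ioi.mp ht).le

theorem mellinConvergent_log_pow_smul_iff (g : ℝ → ℂ) (k : ℕ) (z : ℂ) :
    MellinConvergent (fun t => Real.log t ^ k • g t) z ↔
      IntegrableOn (fun t : ℝ => powLog (z - 1) k t * g t) (Set.Ioi 0) :=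
  integrableOn_congr_fun (fun _ ht => cpow_smul_log_pow_smul k (z - 1) _ (Set.mem_Ioi.mp ht).le)
    measurableSet_Ioi

variable {z : ℂ}

theorem integrableOn_powLog_mul_exp_neg (k : ℕ) (hz : 0 < z.re) :
    IntegrableOn (fun t : ℝ => powLog (z - 1) k t * Complex.exp (-t)) (Set.Ioi 0) := by
  have h := ((hasMellinStrip_exp_neg (z.re + 1)).log_pow_smul k).mellinConvergent hz
    (lt_add_one _)
  rw [mellinConvergent_log_pow_smul_iff] at h
  simpa using h

theorem iteratedDeriv_Gamma_eq_integral (k : ℕ) (hz : 0 < z.re) :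
    iteratedDeriv k Complex.Gamma z =
      ∫ t in Set.Ioi (0 : ℝ), powLog (z - 1) k t * Complex.exp (-t) := by
  have hGamma : Complex.Gamma =ᶠ[𝓝 z] mellin fun t => (Real.exp (-t) : ℂ) := by
    filter_upwards [(isOpen_lt continuous_const Complex.continuous_re).mem_nhds hz] with w hw
    rw [Complex.Gamma_eq_integral hw, Complex.GammaIntegral_eq_mellin]
  rw [hGamma.iteratedDeriv_eq, (hasMellinStrip_exp_neg (z.re + 1)).iteratedDeriv_mellin k hz
    (lt_add_one _), mellin_log_pow_smul_eq_integral_powLog]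
  simp

theorem powLog_mul_indicator_one (S : Set ℝ) (k : ℕ) (z : ℂ) (t : ℝ) :
    powLog z k t * S.indicator (fun _ => 1 : ℝ → ℂ) t =
      S.indicator (fun t : ℝ => powLog z k t) t := by
  by_cases ht : t ∈ S <;> simp [ht]

theorem integrableOn_powLog_Ioc (k : ℕ) (hz : 0 < z.re) :
    IntegrableOn (fun t : ℝ => powLog (z - 1) k t) (Set.Ioc 0 1) := by
  have h := ((hasMellinStrip_indicator_Ioc (z.re + 1)).log_pow_smul k).mellinConvergent hz
    (lt_add_one _)
  simp only [mellinConvergent_log_pow_smul_iff, powLog_mul_indicator_one] at h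
  rwa [integrableOn_indicator_iff measurableSet_Ioc,
    Set.inter_eq_left.mpr Set.Ioc_subset_Ioi_self] at h

theorem integral_powLog_Ioc (k : ℕ) (hz : 0 < z.re) :
    ∫ t in Set.Ioc (0 : ℝ) 1, powLog (z - 1) k t = (-1) ^ k * k.factorial / z ^ (k + 1) := by
  have hinv : (mellin ((Set.Ioc 0 1).indicator fun _ => 1 : ℝ → ℂ)) =ᶠ[𝓝 z] Inv.inv := by
    filter_upwards [(isOpen_lt continuous_const Complex.continuous_re).mem_nhds hz] with w hw
    rw [(hasMellin_one_Ioc hw).2, one_div]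
  have h := (hasMellinStrip_indicator_Ioc (z.re + 1)).iteratedDeriv_mellin k hz (lt_add_one _)
  rw [hinv.iteratedDeriv_eq, iteratedDeriv_eq_iterate, iter_deriv_inv,
    mellin_log_pow_smul_eq_integral_powLog] at h
  simp only [powLog_mul_indicator_one] at h
  rw [setIntegral_indicator measurableSet_Ioc,
    Set.inter_eq_right.mpr Set.Ioc_subset_Ioi_self] at h
  rw [← h, div_eq_mul_inv, ← zpow_natCast z, ← zpow_neg]
  congr 2
  push_cast
  ring

theorem hasSum_integral_pow_mul {α : Type*} [MeasurableSpace α] {μ : Measure α} {f h : α → ℂ}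
    {M : ℝ} (hf : AEStronglyMeasurable f μ) (hM : ∀ᵐ x ∂μ, ‖f x‖ ≤ M) (hh : Integrable h μ) :
    HasSum (fun n : ℕ => ∫ x, f x ^ n / n.factorial * h x ∂μ)
      (∫ x, Complex.exp (f x) * h x ∂μ) := by
  have hexp (x : ℂ) : HasSum (fun n : ℕ => x ^ n / n.factorial) (Complex.exp x) := by
    rw [Complex.exp_eq_exp_ℂ]
    exact NormedSpace.expSeries_div_hasSum_exp x
  have hsummable (x : α) : Summable fun n : ℕ => M ^ n / n.factorial * ‖h x‖ :=
    (Real.summable_pow_div_factorial M).mul_right _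
  refine hasSum_integral_of_dominated_convergence
    (fun n x => M ^ n / n.factorial * ‖h x‖) (fun n => ?_) (fun n => ?_) (.of_forall hsummable)
    ?_ (.of_forall fun x => (hexp (f x)).mul_right (h x))
  · simp only [div_eq_mul_inv]
    exact ((hf.pow n).mul_const _).mul hh.aestronglyMeasurable
  · filter_upwards [hM] with x hx
    rw [norm_mul, norm_div, norm_pow, Complex.norm_natCast]
    gcongr
  · simp only [tsum_mul_right]
    exact hh.norm.const_mul _

theorem powLog_add_natCast (α : ℂ) (k n : ℕ) {w : ℂ} (hw : w ≠ 0) :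
    powLog (α + n) k w = w ^ n * powLog α k w := by
  rw [powLog, powLog, Complex.cpow_add _ _ hw, Complex.cpow_natCast]
  ring

theorem hasSum_integral_powLog_mul_exp_neg (k : ℕ) (hz : 0 < z.re) :
    HasSum (fun n : ℕ => (-1) ^ n / n.factorial * ((-1) ^ k * k.factorial / (n + z) ^ (k + 1)))
      (∫ t in Set.Ioc (0 : ℝ) 1, powLog (z - 1) k t * Complex.exp (-t)) := by
  have hbound : ∀ᵐ t : ℝ ∂volume.restrict (Set.Ioc 0 1), ‖(-t : ℂ)‖ ≤ 1 := by
    filter_upwards [ae_restrict_mem measurableSet_Ioc] with t ht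
    rw [norm_neg, Complex.norm_of_nonneg ht.1.le]
    exact ht.2
  have h := hasSum_integral_pow_mul (f := fun t : ℝ => (-t : ℂ)) (by fun_prop) hbound
    (integrableOn_powLog_Ioc k hz)
  simp only [mul_comm (Complex.exp _)] at h
  refine h.congr_fun fun n => ?_
  have hn : 0 < (n + z).re := by
    simpa using add_pos_of_nonneg_of_pos n.cast_nonneg hz
  rw [← integral_powLog_Ioc k hn, ← integral_const_mul]
  refine setIntegral_congr_fun measurableSet_Ioc fun t ht => ?_
  have ht0 : (t : ℂ) ≠ 0 := Complex.ofReal_ne_zero.mpr ht.1.ne'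
  simp only [add_comm (n : ℂ) z, add_sub_right_comm z, powLog_add_natCast _ k n ht0,
    neg_pow (t : ℂ)]
  ring

theorem integral_Ioi_one_powLog_mul_exp_neg (α : ℂ) (k : ℕ) :
    ∫ t in Set.Ioi (1 : ℝ), powLog α k t * Complex.exp (-t) =
      Complex.exp (-1) * ∫ t in Set.Ioi (0 : ℝ), powLog α k (1 + t) * Complex.exp (-t) := by
  have h := (measurePreserving_add_left volume (1 : ℝ)).setIntegral_preimage_emb
    (measurableEmbedding_addLeft 1) (fun t : ℝ => powLog α k t * Complex.exp (-t)) (Set.Ioi 1)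
  rw [← h, Set.preimage_const_add_Ioi, sub_self, ← integral_const_mul]
  congr 1 with t
  rw [Complex.ofReal_add, Complex.ofReal_one, neg_add, Complex.exp_add]
  ring

theorem iteratedDeriv_Gamma_eq_Ioc_add (k : ℕ) (hz : 0 < z.re) :
    iteratedDeriv k Complex.Gamma z =
      (∫ t in Set.Ioc (0 : ℝ) 1, powLog (z - 1) k t * Complex.exp (-t)) +
        Complex.exp (-1) * ∫ t in Set.Ioi (0 : ℝ), powLog (z - 1) k (1 + t) * Complex.exp (-t) := by
  have h := integrableOn_powLog_mul_exp_neg k hz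
  rw [iteratedDeriv_Gamma_eq_integral k hz, ← integral_Ioi_one_powLog_mul_exp_neg,
    ← setIntegral_union (Set.Ioc_disjoint_Ioi le_rfl) measurableSet_Ioi
      (h.mono_set Set.Ioc_subset_Ioi_self) (h.mono_set (Set.Ioi_subset_Ioi zero_le_one)),
    Set.Ioc_union_Ioi_eq_Ioi zero_le_one]

theorem exists_hasValueAt_seriesE_iteratedDeriv_Gamma (k : ℕ) {a : ℚ} (ha : 0 < a) :
    ∃ u : ℂ, HasValueAt (seriesE a (k + 1)) (-1) u ∧
      iteratedDeriv k Complex.Gamma a = (-1) ^ k * k.factorial * u +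
        Complex.exp (-1) *
          ∫ t in Set.Ioi (0 : ℝ), powLog (a - 1) k (1 + t) * Complex.exp (-t) := by
  have hre : 0 < (a : ℂ).re := by exact_mod_cast ha
  have hfact : (k.factorial : ℂ) ≠ 0 := Nat.cast_ne_zero.mpr k.factorial_ne_zero
  have hk : (-1 : ℂ) ^ k * k.factorial ≠ 0 := mul_ne_zero (by simp) hfact
  have hsum := (hasSum_integral_powLog_mul_exp_neg k hre).mul_left ((-1) ^ k * k.factorial : ℂ)⁻¹
  refine ⟨_, hsum.congr_fun fun n => ?_, ?_⟩
  · rw [seriesE, PowerSeries.coeff_mk]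
    push_cast
    field_simp
  · rw [mul_inv_cancel_left₀ hk, iteratedDeriv_Gamma_eq_Ioc_add k hre]

end GammaDerivatives

theorem exp_neg_one_mul_mem_valuesMixed {u v : ℂ} (c : Qbar) (hu : u ∈ valuesE)
    (hv : v ∈ valuesD) : c * u + Complex.exp (-1) * v ∈ Complex.exp (-1) • valuesMixed := by
  have hmem : Complex.exp 1 * (c * u) + v ∈ valuesMixed := by
    rw [valuesMixed_eq_add]
    exact Set.add_mem_add (mul_mem_valuesE (by simpa using exp_mem_valuesE 1)
      (mul_mem_valuesE (coe_mem_valuesE c) hu)) hv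
  refine ⟨_, hmem, ?_⟩
  simp only [smul_eq_mul]
  rw [mul_add, ← mul_assoc, ← Complex.exp_add, neg_add_cancel, Complex.exp_zero, one_mul]

theorem mainTheorem8 :
    valuesMixed = valuesE + valuesD ∧
    ∀ (s : ℕ) (a : ℚ), 0 < a →
      iteratedDeriv s Complex.Gamma (a : ℂ) ∈ Complex.exp (-1) • valuesMixed ∧
      IsEFunction (seriesE a (s + 1)) ∧
      IsAntieFunction (seriesAntie a s) ∧
      ¬ IsAntiStokes (seriesAntie a s) 0 ∧
      ∃ u v : ℂ,
        HasValueAt (seriesE a (s + 1)) (-1) u ∧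
        HasOneSumAt (seriesAntie a s) 0 1 v ∧
        v = ((∫ t in Set.Ioi (0 : ℝ),
          (1 + t) ^ ((a : ℝ) - 1) * Real.log (1 + t) ^ s * Real.exp (-t) : ℝ) : ℂ) ∧
        iteratedDeriv s Complex.Gamma (a : ℂ) =
          (-1) ^ s * (s.factorial : ℂ) * u + Complex.exp (-1) * v := by
  refine ⟨valuesMixed_eq_add, fun s a ha => ?_⟩
  have hE : IsEFunction (seriesE a (s + 1)) := isEFunction_seriesE (fun n => by positivity) _
  have hAntie := isAntieFunction_seriesAntie a s
  have hStokes : ¬ IsAntiStokes (seriesAntie a s) 0 :=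
    not_not.mpr ⟨_, isBorelContinuation_seriesAntie a s⟩
  obtain ⟨u, hu, hΓ⟩ := exists_hasValueAt_seriesE_iteratedDeriv_Gamma s ha
  have hv := hasOneSumAt_seriesAntie a s
  refine ⟨?_, hE, hAntie, hStokes, u, _, hu, hv, ?_, hΓ⟩
  · rw [hΓ]
    simpa using exp_neg_one_mul_mem_valuesMixed ((-1) ^ s * s.factorial)
      ⟨_, hE, -1, by simpa using hu⟩ ⟨_, hAntie, Or.inl ⟨hStokes, hv⟩⟩
  · simpa using integral_powLog_one_add_mul_exp_neg (a - 1) s
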